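/- Let $d\ge 2$ and let $\Omega\subset\mathbb{R}^d$ be a bounded Lipschitz domain (a bounded open set that is, locally near each boundary point and after a rigid motion, the region below the graph of a Lipschitz function), with boundary $\Gamma=\partial\Omega$ and exterior unit normal $\boldsymbol n$. All functions are real-valued. Let $H^1(\Omega)$ be the space of $\varphi\in L^2(\Omega)$ with weak gradient $\nabla\varphi\in L^2(\Omega)^d$, let $H(\mathrm{div},\Omega)$ be the space of $\boldsymbol\sigma\in L^2(\Omega)^d$ with weak divergence $\mathrm{div}\,\boldsymbol\sigma\in L^2(\Omega)$, and let $\varphi\mapsto\varphi|_\Gamma$ be the trace operator $H^1(\Omega)\to L^2(\Gamma)$, i.e. the continuous extension of the restriction to $\Gamma$ of functions smooth up to the boundary. Put $H^{1/2}(\Gamma)=\{\varphi|_\Gamma:\varphi\in H^1(\Omega)\}$ with the quotient norm $\|f\|_{H^{1/2}(\Gamma)}=\inf\{\|\varphi\|_{H^1(\Omega)}:\varphi|_\Gamma=f\}$, let $H^{-1/2}(\Gamma)$ be its dual with duality product $\langle\cdot,\cdot\rangle_\Gamma$, and for $\boldsymbol\sigma\in H(\mathrm{div},\Omega)$ let $\boldsymbol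 n\cdot\boldsymbol\sigma|_\Gamma\in H^{-1/2}(\Gamma)$ be the normal trace, given by $\langle\varphi|_\Gamma,\boldsymbol n\cdot\boldsymbol\sigma|_\Gamma\rangle_\Gamma=\int_\Omega\nabla\varphi\cdot\boldsymbol\sigma\,dx+\int_\Omega\varphi\,\mathrm{div}\,\boldsymbol\sigma\,dx$ for all $\varphi\in H^1(\Omega)$. Let $g\in H^{1/2}(\Gamma)$ and let $u\in H^1(\Omega)$ be the unique solution of $\Delta u=0$ in $\Omega$ (in the sense of distributions) with $u|_\Gamma=g$. Let $v\in H^1(\Omega)$ be any function with $\Delta v=0$ in $\Omega$. Then $$\max_{\substack{\boldsymbol\tau\in L^2(\Omega)^d\\ \mathrm{div}\,\boldsymbol\tau=0}}\Big(2\,\langle g-v|_\Gamma,\boldsymbol n\cdot\boldsymbol\tau|_\Gamma\rangle_\Gamma-\|\boldsymbol\tau\|_{L^2(\Omega)}^2\Big)=\|\nabla(u-v)\|_{L^2(\Omega)}^2=\min_{\substack{w\in H^1(\Omega)\\ w|_\Gamma=g-v|_\Gamma}}\|\nabla w\|_{L^2(\Omega)}^2 .$$ Both extrema are attained; the unique maximiser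 is $\boldsymbol\tau=\nabla(u-v)$ and the unique minimiser is $w=u-v$. -/

import Mathlib

open MeasureTheory
open scoped ContDiff

noncomputable section

namespace FunctionalError

/-- Euclidean space `ℝ^d`. -/
abbrev E (d : ℕ) : Type := EuclideanSpace ℝ (Fin d)

/-- Bounded Lipschitz domain: a bounded open set which, near every boundary point and after a rigid
motion of coordinates, lies strictly below the graph of a Lipschitz function of `d - 1` variables
(the Lipschitz function absorbs the translation).  Connectedness is not required. -/
structure IsBoundedLipschitzDomain {d : ℕ} (Ω : Set (E d)) : Prop where
  isOpen : IsOpen Ω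
  isBounded : Bornology.IsBounded Ω
  locally_subgraph : ∀ x ∈ frontier Ω,
    ∃ (R : E d ≃ₗᵢ[ℝ] WithLp 2 (E (d - 1) × ℝ)) (K : NNReal) (γ : E (d - 1) → ℝ),
      LipschitzWith K γ ∧ ∃ U ∈ nhds x, ∀ y ∈ U, y ∈ Ω ↔ (R y).snd < γ (R y).fst

variable {d : ℕ}

/-- The surface measure on `Γ = ∂Ω`: the `(d-1)`-dimensional Hausdorff measure, normalised to agree
with Lebesgue measure on `(d-1)`-dimensional planes. -/
def surface (Ω : Set (E d)) : Measure (E d) :=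
  (Measure.euclideanHausdorffMeasure (d - 1)).restrict (frontier Ω)

/-- `L²(Ω)`, scalar functions. -/
abbrev L2 (Ω : Set (E d)) : Type := Lp ℝ 2 (volume.restrict Ω)

/-- `L²(Ω)`, vector fields. -/
abbrev L2v (Ω : Set (E d)) : Type := Lp (E d) 2 (volume.restrict Ω)

/-- `L²(Γ)`. -/
abbrev L2Γ (Ω : Set (E d)) : Type := Lp ℝ 2 (surface Ω)

/-- Test functions `φ ∈ C_c^∞(Ω)`. -/
structure IsTest (Ω : Set (E d)) (φ : E d → ℝ) : Prop where
  contDiff : ContDiff ℝ ∞ φ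
  hasCompactSupport : HasCompactSupport φ
  tsupport_subset : tsupport φ ⊆ Ω

/-- `G` is the weak gradient of `u` in `Ω`. -/
def HasWeakGrad (Ω : Set (E d)) (u : L2 Ω) (G : L2v Ω) : Prop :=
  ∀ φ : E d → ℝ, IsTest Ω φ →
    ∫ x in Ω, u x • gradient φ x = -∫ x in Ω, φ x • G x

/-- `f` is the weak divergence of `σ` in `Ω`. -/
def HasWeakDiv (Ω : Set (E d)) (σ : L2v Ω) (f : L2 Ω) : Prop :=
  ∀ φ : E d → ℝ, IsTest Ω φ →
    ∫ x in Ω, inner ℝ (σ x) (gradient φ x) = -∫ x in Ω, f x * φ x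

theorem IsTest.memLp {Ω : Set (E d)} {φ : E d → ℝ} (h : IsTest Ω φ) :
    MemLp φ 2 (volume.restrict Ω) :=
  h.contDiff.continuous.memLp_of_hasCompactSupport h.hasCompactSupport

theorem IsTest.memLp_gradient {Ω : Set (E d)} {φ : E d → ℝ} (h : IsTest Ω φ) :
    MemLp (gradient φ) 2 (volume.restrict Ω) := by
  have hc : Continuous (gradient φ) :=
    (InnerProductSpace.toDual ℝ (E d)).symm.continuous.comp
      (h.contDiff.continuous_fderiv (by simp))
  have hs : HasCompactSupport (gradient φ) :=
    (h.hasCompactSupport.fderiv (𝕜 := ℝ)).comp_left (map_zero _)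
  exact hc.memLp_of_hasCompactSupport hs

theorem integrable_smul_of_memLp {F : Type*} [NormedAddCommGroup F] [NormedSpace ℝ F]
    {μ : Measure (E d)} {f : E d → ℝ} {G : E d → F} (hf : MemLp f 2 μ) (hG : MemLp G 2 μ) :
    Integrable (fun x => f x • G x) μ :=
  memLp_one_iff_integrable.1 (hG.smul hf)

/-- The Sobolev space `H¹(Ω)`.  An element is a function of `L²(Ω)` together with its weak gradient
(which is unique) in `L²(Ω)`, so that `H¹(Ω)` carries its usual Hilbert space norm
`(‖φ‖² + ‖∇φ‖²)^{1/2}`. -/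
def H1 (Ω : Set (E d)) : Submodule ℝ (WithLp 2 (L2 Ω × L2v Ω)) where
  carrier := {w | HasWeakGrad Ω w.fst w.snd}
  zero_mem' := by
    intro φ hφ
    have h1 : ∫ x in Ω, (0 : L2 Ω) x • gradient φ x = 0 := by
      refine integral_eq_zero_of_ae ?_
      filter_upwards [Lp.coeFn_zero ℝ 2 (volume.restrict Ω)] with x hx
      rw [hx]
      simp
    have h2 : ∫ x in Ω, φ x • (0 : L2v Ω) x = 0 := by
      refine integral_eq_zero_of_ae ?_
      filter_upwards [Lp.coeFn_zero (E d) 2 (volume.restrict Ω)] with x hx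
      rw [hx]
      simp
    simp only [WithLp.zero_fst, WithLp.zero_snd, h1, h2, neg_zero]
  add_mem' := by
    intro a b ha hb φ hφ
    have h1 : ∫ x in Ω, (a.fst + b.fst : L2 Ω) x • gradient φ x
        = (∫ x in Ω, a.fst x • gradient φ x) + ∫ x in Ω, b.fst x • gradient φ x := by
      rw [← integral_add (integrable_smul_of_memLp (Lp.memLp _) hφ.memLp_gradient)
        (integrable_smul_of_memLp (Lp.memLp _) hφ.memLp_gradient)]
      refine integral_congr_ae ?_
      filter_upwards [Lp.coeFn_add a.fst b.fst] with x hx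
      rw [hx, Pi.add_apply, add_smul]
    have h2 : ∫ x in Ω, φ x • (a.snd + b.snd : L2v Ω) x
        = (∫ x in Ω, φ x • a.snd x) + ∫ x in Ω, φ x • b.snd x := by
      rw [← integral_add (integrable_smul_of_memLp hφ.memLp (Lp.memLp _))
        (integrable_smul_of_memLp hφ.memLp (Lp.memLp _))]
      refine integral_congr_ae ?_
      filter_upwards [Lp.coeFn_add a.snd b.snd] with x hx
      rw [hx, Pi.add_apply, smul_add]
    simp only [WithLp.add_fst, WithLp.add_snd]
    rw [h1, h2, ha φ hφ, hb φ hφ, neg_add]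
  smul_mem' := by
    intro c a ha φ hφ
    have h1 : ∫ x in Ω, (c • a.fst : L2 Ω) x • gradient φ x
        = c • ∫ x in Ω, a.fst x • gradient φ x := by
      rw [← integral_smul]
      refine integral_congr_ae ?_
      filter_upwards [Lp.coeFn_smul c a.fst] with x hx
      simp [hx, mul_smul]
    have h2 : ∫ x in Ω, φ x • (c • a.snd : L2v Ω) x = c • ∫ x in Ω, φ x • a.snd x := by
      rw [← integral_smul]
      refine integral_congr_ae ?_
      filter_upwards [Lp.coeFn_smul c a.snd] with x hx
      simp [hx, smul_comm c]
    simp only [WithLp.smul_fst, WithLp.smul_snd]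
    rw [h1, h2, ha φ hφ, smul_neg]

/-- The underlying `L²` function of an element of `H¹(Ω)`. -/
def fn {Ω : Set (E d)} (w : H1 Ω) : L2 Ω := w.1.fst

/-- The weak gradient of an element of `H¹(Ω)`. -/
def grad {Ω : Set (E d)} (w : H1 Ω) : L2v Ω := w.1.snd

/-- `w ∈ H¹(Ω)` with `Δ w = div ∇ w = 0` in the sense of distributions in `Ω`. -/
def IsHarmonic {Ω : Set (E d)} (w : H1 Ω) : Prop := HasWeakDiv Ω (grad w) 0

/-- The space `H(div, Ω)` of `L²` vector fields with weak divergence in `L²`. -/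
structure Hdiv (Ω : Set (E d)) where
  /-- the vector field -/
  field : L2v Ω
  /-- its divergence -/
  div : L2 Ω
  hasWeakDiv : HasWeakDiv Ω field div

/-- The smooth part of the graph of the trace operator: restrictions to `Ω` and to `Γ` of the same
smooth function on `ℝ^d`. -/
def smoothTraceGraph (Ω : Set (E d)) : Submodule ℝ (H1 Ω × L2Γ Ω) where
  carrier := {p | ∃ φ : E d → ℝ, ContDiff ℝ ∞ φ ∧
    fn p.1 =ᵐ[volume.restrict Ω] φ ∧ p.2 =ᵐ[surface Ω] φ}
  zero_mem' := ⟨0, contDiff_const, Lp.coeFn_zero _ _ _, Lp.coeFn_zero _ _ _⟩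
  add_mem' := by
    rintro a b ⟨φ, hφ, h1, h2⟩ ⟨ψ, hψ, h3, h4⟩
    exact ⟨φ + ψ, hφ.add hψ, (Lp.coeFn_add _ _).trans (h1.add h3),
      (Lp.coeFn_add _ _).trans (h2.add h4)⟩
  smul_mem' := by
    rintro c a ⟨φ, hφ, h1, h2⟩
    exact ⟨c • φ, contDiff_const.smul hφ, (Lp.coeFn_smul _ _).trans (h1.const_smul c),
      (Lp.coeFn_smul _ _).trans (h2.const_smul c)⟩

/-- The graph of the trace operator `H¹(Ω) → L²(Γ)`, i.e. of the continuous extension of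
`φ ↦ φ|_Γ`: the closure in `H¹(Ω) × L²(Γ)` of the graph on smooth functions. -/
def traceGraph (Ω : Set (E d)) : Submodule ℝ (H1 Ω × L2Γ Ω) :=
  (smoothTraceGraph Ω).topologicalClosure

/-- `f ∈ L²(Γ)` is the trace of `w ∈ H¹(Ω)`. -/
def IsTrace {Ω : Set (E d)} (w : H1 Ω) (f : L2Γ Ω) : Prop := (w, f) ∈ traceGraph Ω

/-- The trace space `H^{1/2}(Γ)`: all `f ∈ L²(Γ)` that are the trace of some `w ∈ H¹(Ω)`. -/
def Hhalf (Ω : Set (E d)) : Submodule ℝ (L2Γ Ω) :=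
  (traceGraph Ω).map (LinearMap.snd ℝ (H1 Ω) (L2Γ Ω))

/-- The trace operator `w ↦ w|_Γ` from `H¹(Ω)` onto `H^{1/2}(Γ)`. -/
def trace {Ω : Set (E d)} (w : H1 Ω) : Hhalf Ω :=
  Classical.epsilon fun f : Hhalf Ω => IsTrace w (f : L2Γ Ω)

/-- The dual space `H^{-1/2}(Γ)` of `H^{1/2}(Γ)`: linear functionals `ℓ` that are bounded for the
quotient norm `‖f‖ = inf {‖w‖_{H¹(Ω)} : w|_Γ = f}`.  The duality product `⟨f, ℓ⟩` is `ℓ f`. -/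
def HmHalf (Ω : Set (E d)) : Submodule ℝ (Module.Dual ℝ (Hhalf Ω)) where
  carrier := {ℓ | ∃ C : ℝ, ∀ (w : H1 Ω) (f : Hhalf Ω), IsTrace w (f : L2Γ Ω) → |ℓ f| ≤ C * ‖w‖}
  zero_mem' := ⟨0, fun w f _ => by simp⟩
  add_mem' := by
    rintro a b ⟨C, hC⟩ ⟨D, hD⟩
    refine ⟨C + D, fun w f h => ?_⟩
    calc |(a + b) f| ≤ |a f| + |b f| := abs_add_le _ _
      _ ≤ (C + D) * ‖w‖ := by linarith [hC w f h, hD w f h]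
  smul_mem' := by
    rintro c a ⟨C, hC⟩
    refine ⟨|c| * C, fun w f h => ?_⟩
    have := mul_le_mul_of_nonneg_left (hC w f h) (abs_nonneg c)
    simpa [abs_mul, mul_assoc] using this

/-- The duality product on `H^{1/2}(Γ) × H^{-1/2}(Γ)`. -/
def dualPairing {Ω : Set (E d)} (f : Hhalf Ω) (ℓ : HmHalf Ω) : ℝ := (ℓ : Module.Dual ℝ (Hhalf Ω)) f

/-- The normal trace `n · σ|_Γ ∈ H^{-1/2}(Γ)` of `σ ∈ H(div, Ω)`: the functional given by Green's
formula `⟨φ|_Γ, n · σ|_Γ⟩ = (∇φ, σ)_{L²(Ω)} + (φ, div σ)_{L²(Ω)}` for all `φ ∈ H¹(Ω)`. -/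
def normalTrace {Ω : Set (E d)} (σ : Hdiv Ω) : HmHalf Ω :=
  Classical.epsilon fun ℓ : HmHalf Ω => ∀ (φ : H1 Ω) (f : Hhalf Ω), IsTrace φ (f : L2Γ Ω) →
    dualPairing f ℓ = inner ℝ (grad φ) σ.field + inner ℝ (fn φ) σ.div

/-- The minorant `2 ⟨g - γ, n · τ|_Γ⟩ - ‖τ‖²`, to be used with `γ = v|_Γ`. -/
def minorant {Ω : Set (E d)} (τ : Hdiv Ω) (γ g : Hhalf Ω) : ℝ :=
  2 * dualPairing (g - γ) (normalTrace τ) - ‖τ.field‖ ^ 2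

/-- The majorant `‖σ‖²`, to be used with `σ = ∇w`. -/
def majorant {Ω : Set (E d)} (σ : L2v Ω) : ℝ := ‖σ‖ ^ 2

end FunctionalError

end

/-! Put `e = u - v`, a harmonic function with trace `g - trace v`. For a solenoidal `τ`, the
definition of the normal trace turns the duality product into `(∇e, τ)`, and completing the square
gives `minorant = ‖∇e‖² - ‖τ - ∇e‖²`. For a competitor `w`, the difference `w - e` has zero trace,
so `∇(w - e)` is orthogonal to the solenoidal field `∇e`, and Pythagoras gives `‖∇w‖² = ‖∇e‖² + ‖∇(w
- e)‖²`. Both extrema and the unique maximiser can be read off; the unique minimiser also needs that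
a function with zero trace and zero gradient vanishes.

The work lies in justifying traces and Green's formula on a Lipschitz domain. Three facts carry it.
Every element of `H1 Ω` has exactly one trace (`exists_isTrace`, `IsTrace.unique`), from a trace
inequality on smooth functions together with their density. A function with zero trace, extended by
zero, is weakly differentiable on the whole space (`IsTrace.weakDeriv_univ`). Green's formula
without boundary term holds in `Ω` as soon as one of its two factors extends by zero in this sense
(`GreenPair.green_of_extends`). The last fact also yields density: an element orthogonal to all
smooth functions has a gradient field that extends by zero. -/

noncomputable section

namespace FunctionalError

/-! ### Weak derivatives and Green's formula on the whole space -/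

section WeakDerivatives

variable {d : ℕ} {V W : Type*} [NormedAddCommGroup V] [InnerProductSpace ℝ V]
  [NormedAddCommGroup W] [InnerProductSpace ℝ W]

theorem inner_gradient {φ : E d → ℝ} (x v : E d) : inner ℝ (gradient φ x) v = fderiv ℝ φ x v := by
  rw [gradient, InnerProductSpace.toDual_symm_apply]

theorem continuous_gradient {φ : E d → ℝ} (h : ContDiff ℝ ∞ φ) : Continuous (gradient φ) :=
  (InnerProductSpace.toDual ℝ (E d)).symm.continuous.comp (h.continuous_fderiv (by simp))

theorem hasCompactSupport_gradient {φ : E d → ℝ} (h : HasCompactSupport φ) :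
    HasCompactSupport (gradient φ) :=
  (h.fderiv (𝕜 := ℝ)).comp_left (map_zero _)

theorem support_gradient_subset (φ : E d → ℝ) : Function.support (gradient φ) ⊆ tsupport φ := by
  intro x hx
  refine support_fderiv_subset ℝ fun h => hx ?_
  rw [gradient, h, map_zero]

theorem gradient_mul {φ ψ : E d → ℝ} {x : E d} (hφ : DifferentiableAt ℝ φ x)
    (hψ : DifferentiableAt ℝ ψ x) :
    gradient (fun y => φ y * ψ y) x = φ x • gradient ψ x + ψ x • gradient φ x := by
  rw [gradient, fderiv_fun_mul hφ hψ, map_add, map_smul, map_smul]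
  rfl

theorem _root_.ContDiff.differentiableAt_infty {φ : E d → ℝ} (h : ContDiff ℝ ∞ φ) (x : E d) :
    DifferentiableAt ℝ φ x := (h.differentiable (by simp)) x

theorem integrable_bilin {μ : Measure (E d)} {V W Z : Type*} [NormedAddCommGroup V]
    [NormedSpace ℝ V] [NormedAddCommGroup W] [NormedSpace ℝ W] [NormedAddCommGroup Z]
    [NormedSpace ℝ Z] (B : V →L[ℝ] W →L[ℝ] Z) {a : E d → V} {b : E d → W}
    (ha : MemLp a 2 μ) (hb : MemLp b 2 μ) : Integrable (fun x => B (a x) (b x)) μ := by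
  rw [← memLp_one_iff_integrable]
  refine MemLp.of_bilin (fun v w => B v w) ‖B‖₊ ha hb
    (B.aestronglyMeasurable_comp₂ ha.1 hb.1) (Filter.Eventually.of_forall fun x => ?_)
  exact B.le_opNorm₂ _ _

theorem memLp_bilin {μ : Measure (E d)} {V W Z : Type*} [NormedAddCommGroup V]
    [NormedSpace ℝ V] [NormedAddCommGroup W] [NormedSpace ℝ W] [NormedAddCommGroup Z]
    [NormedSpace ℝ Z] (B : V →L[ℝ] W →L[ℝ] Z) {a : E d → V} {b : E d → W}
    (ha : MemLp a 2 μ) (hb : Continuous b) (hb' : HasCompactSupport b) :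
    MemLp (fun x => B (a x) (b x)) 2 μ := by
  refine MemLp.of_bilin (q := ⊤) (fun v w => B v w) ‖B‖₊ ha
    (hb.memLp_top_of_hasCompactSupport hb' μ)
    (B.aestronglyMeasurable_comp₂ ha.1 hb.aestronglyMeasurable)
    (Filter.Eventually.of_forall fun x => ?_)
  exact B.le_opNorm₂ _ _

theorem memLp_smul {μ : Measure (E d)} {η : E d → ℝ} {a : E d → V} (ha : MemLp a 2 μ)
    (hη : Continuous η) (hη' : HasCompactSupport η) : MemLp (fun x => η x • a x) 2 μ :=
  memLp_bilin (ContinuousLinearMap.lsmul ℝ ℝ).flip ha hη hη'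

theorem integrable_inner {μ : Measure (E d)} {a b : E d → V} (ha : MemLp a 2 μ)
    (hb : MemLp b 2 μ) : Integrable (fun x => inner ℝ (a x) (b x)) μ :=
  integrable_bilin (innerSL ℝ) ha hb

/-- `A` is the weak derivative of `a` on `O` for the first order operator whose symbol is the
bilinear map `B`: the scalar product gives the divergence, multiplication the gradient. -/
def WeakDeriv (B : V →L[ℝ] E d →L[ℝ] W) (O : Set (E d)) (a : E d → V) (A : E d → W) : Prop :=
  ∀ φ : E d → ℝ, IsTest O φ → ∫ x, B (a x) (gradient φ x) = -∫ x, φ x • A x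

theorem IsTest.mul {O : Set (E d)} {η φ : E d → ℝ} (hη : ContDiff ℝ ∞ η) (hφ : IsTest O φ) :
    IsTest O (fun x => η x * φ x) where
  contDiff := hη.mul hφ.contDiff
  hasCompactSupport := hφ.hasCompactSupport.mul_left
  tsupport_subset := (tsupport_mul_subset_right (f := η) (g := φ)).trans hφ.tsupport_subset

theorem IsTest.mul_left {O : Set (E d)} {η φ : E d → ℝ} (hη : IsTest O η) (hφ : ContDiff ℝ ∞ φ) :
    IsTest O (fun x => η x * φ x) where
  contDiff := hη.contDiff.mul hφ
  hasCompactSupport := hη.hasCompactSupport.mul_right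
  tsupport_subset := (tsupport_mul_subset_left (f := η) (g := φ)).trans hη.tsupport_subset

/-- This is the product rule. The hypothesis `hO` leaves open which factor localises the test
function: a cutoff `η` supported in `O` passes from `O` to the whole space, while a general `η`
stays on the same set. -/
theorem WeakDeriv.smul {B : V →L[ℝ] E d →L[ℝ] W} {O O' : Set (E d)} {a : E d → V} {A : E d → W}
    (h : WeakDeriv B O a A) (ha : MemLp a 2 volume) (hA : MemLp A 2 volume) {η : E d → ℝ}
    (hη : ContDiff ℝ ∞ η) (hηc : HasCompactSupport η)
    (hO : ∀ φ, IsTest O' φ → IsTest O (fun x => η x * φ x)) :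
    WeakDeriv B O' (fun x => η x • a x) (fun x => η x • A x + B (a x) (gradient η x)) := by
  intro φ hφ
  have hg : ∀ x, B (η x • a x) (gradient φ x) =
      B (a x) (gradient (fun y => η y * φ y) x) - φ x • B (a x) (gradient η x) := by
    intro x
    rw [gradient_mul (hη.differentiableAt_infty x) (hφ.contDiff.differentiableAt_infty x)]
    simp
  have hφ2 : MemLp φ 2 volume :=
    hφ.contDiff.continuous.memLp_of_hasCompactSupport hφ.hasCompactSupport
  have i2 : Integrable fun x => φ x • B (a x) (gradient η x) :=
    integrable_smul_of_memLp hφ2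
      (memLp_bilin B ha (continuous_gradient hη) (hasCompactSupport_gradient hηc))
  have hT := hO φ hφ
  have i1 : Integrable fun x => B (a x) (gradient (fun y => η y * φ y) x) :=
    integrable_bilin B ha ((continuous_gradient hT.contDiff).memLp_of_hasCompactSupport
      (hasCompactSupport_gradient hT.hasCompactSupport))
  have i3 : Integrable fun x => φ x • η x • A x :=
    integrable_smul_of_memLp hφ2 (memLp_smul hA hη.continuous hηc)
  simp_rw [hg]
  rw [integral_sub i1 i2, h _ hT]
  simp_rw [smul_add]
  rw [integral_add i3 i2, neg_add, sub_eq_add_neg]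
  congr 3
  ext x
  rw [mul_comm, mul_smul]

theorem IsTest.comp_sub {φ : E d → ℝ} (hφ : IsTest Set.univ φ) (z : E d) :
    IsTest Set.univ (fun x => φ (x - z)) where
  contDiff := hφ.contDiff.comp (contDiff_id.sub contDiff_const)
  hasCompactSupport := hφ.hasCompactSupport.comp_homeomorph (Homeomorph.subRight z)
  tsupport_subset := Set.subset_univ _

theorem gradient_comp_sub (φ : E d → ℝ) (z x : E d) :
    gradient (fun y => φ (y - z)) x = gradient φ (x - z) := by
  rw [gradient, gradient, fderiv_comp_sub]

theorem WeakDeriv.comp_add {B : V →L[ℝ] E d →L[ℝ] W} {a : E d → V} {A : E d → W}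
    (h : WeakDeriv B Set.univ a A) (z : E d) :
    WeakDeriv B Set.univ (fun x => a (x + z)) (fun x => A (x + z)) := by
  intro φ hφ
  have := h _ (hφ.comp_sub z)
  simp_rw [gradient_comp_sub] at this
  rw [← integral_add_right_eq_self _ z, ← integral_add_right_eq_self
    (fun x => φ (x - z) • A x) z] at this
  simpa using this

/-- Translation is strongly continuous on `L²`. This replaces every approximation argument below in
which a shift tends to zero. -/
theorem continuous_integral_inner_translate {f g : E d → V} (hf : MemLp f 2 volume)
    (hg : MemLp g 2 volume) : Continuous fun z => ∫ x, inner ℝ (g x) (f (x + z)) := by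
  have hm : ∀ z : E d, MeasurePreserving (fun x => x + z) volume volume :=
    fun z => measurePreserving_add_right _ z
  let G : C(E d, C(E d, E d)) := ContinuousMap.curry ⟨fun p => p.2 + p.1, by fun_prop⟩
  have hc := Continuous.compMeasurePreservingLp (f := fun _ : E d => hf.toLp f) (g := G)
    continuous_const G.continuous (fun z => hm z) (by simp)
  have : (fun z => ∫ x, inner ℝ (g x) (f (x + z))) =
      fun z => inner ℝ (hg.toLp g) (Lp.compMeasurePreserving (G z) (hm z) (hf.toLp f)) := by
    ext z
    rw [L2.inner_def]
    refine integral_congr_ae ?_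
    filter_upwards [hg.coeFn_toLp, Lp.coeFn_compMeasurePreserving (hf.toLp f) (hm z),
      (hm z).quasiMeasurePreserving.ae hf.coeFn_toLp] with x h1 h2 h3
    have h2' : (Lp.compMeasurePreserving (G z) (hm z) (hf.toLp f)) x = (hf.toLp f) (x + z) := h2
    rw [h1, h2', h3]
  rw [this]
  exact continuous_const.inner hc

theorem integral_inner_mollify {f g : E d → V} (hf : MemLp f 2 volume)
    (hg : MemLp g 2 volume) {ρ : E d → ℝ} (hρ : Continuous ρ) (hρc : HasCompactSupport ρ)
    [CompleteSpace V] :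
    ∫ x, inner ℝ (g x) (∫ t, ρ (x - t) • f t) = ∫ z, ρ z • ∫ x, inner ℝ (g x) (f (x - z)) := by
  have hρi : Integrable ρ := hρ.integrable_of_hasCompactSupport hρc
  have hint : Integrable (Function.uncurry fun x z => ρ z • inner ℝ (g x) (f (x - z)))
      (volume.prod volume) := by
    -- Fubini is justified by `|ρ(z)| |g(x)| |f(x - z)| ≤ |ρ(z)| (|g(x)|² + |f(x - z)|²)`, whose two
    -- terms are integrable on the product.
    have h1 := Integrable.convolution_integrand (ContinuousLinearMap.mul ℝ ℝ) hρi.norm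
      (hf.integrable_norm_pow (p := 2) (by norm_num))
    have h2 := (hg.integrable_norm_pow (p := 2) (by norm_num)).mul_prod hρi.norm
    refine (h1.add h2).mono' ?_ (Filter.Eventually.of_forall fun p => ?_)
    · refine AEStronglyMeasurable.smul hρ.aestronglyMeasurable.comp_snd ?_
      refine AEStronglyMeasurable.inner hg.1.comp_fst ?_
      exact hf.1.comp_quasiMeasurePreserving (quasiMeasurePreserving_sub_of_right_invariant _ _)
    · simp only [Function.uncurry, norm_smul, Pi.add_apply, ContinuousLinearMap.mul_apply']
      have := norm_inner_le_norm (𝕜 := ℝ) (g p.1) (f (p.1 - p.2))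
      nlinarith [norm_nonneg (ρ p.2), sq_nonneg (‖g p.1‖ - ‖f (p.1 - p.2)‖), sq_nonneg ‖g p.1‖,
        sq_nonneg ‖f (p.1 - p.2)‖, mul_le_mul_of_nonneg_left this (norm_nonneg (ρ p.2)),
        mul_nonneg (norm_nonneg (ρ p.2)) (sq_nonneg (‖g p.1‖ - ‖f (p.1 - p.2)‖)),
        mul_nonneg (norm_nonneg (ρ p.2)) (sq_nonneg (‖g p.1‖)),
        mul_nonneg (norm_nonneg (ρ p.2)) (sq_nonneg (‖f (p.1 - p.2)‖))]
  calc ∫ x, inner ℝ (g x) (∫ t, ρ (x - t) • f t)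
      = ∫ x, ∫ z, ρ z • inner ℝ (g x) (f (x - z)) := by
        congr 1
        ext x
        rw [← integral_sub_left_eq_self (fun t => ρ (x - t) • f t) volume x,
          ← integral_inner]
        · simp [inner_smul_right]
        · have h0 : Integrable fun t => ρ (x - t) • f t := by
            refine integrable_bilin (ContinuousLinearMap.lsmul ℝ ℝ) (a := fun t => ρ (x - t))
              (Continuous.memLp_of_hasCompactSupport (by fun_prop)
                (hρc.comp_homeomorph (Homeomorph.subLeft x))) hf
          exact h0.comp_sub_left x
    _ = ∫ z, ∫ x, ρ z • inner ℝ (g x) (f (x - z)) := integral_integral_swap hint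
    _ = _ := by simp_rw [integral_smul]

theorem gradient_mollify {w : E d → ℝ} {G : E d → E d}
    (h : WeakDeriv (ContinuousLinearMap.lsmul ℝ ℝ) Set.univ w G) (hw : MemLp w 2 volume)
    {ρ : E d → ℝ} (hρ : IsTest Set.univ ρ) (x : E d) :
    gradient (fun x => ∫ t, ρ (x - t) • w t) x = ∫ t, ρ (x - t) • G t := by
  have hloc := hw.locallyIntegrable (by norm_num)
  have hd := hρ.hasCompactSupport.hasFDerivAt_convolution_right (ContinuousLinearMap.mul ℝ ℝ)
    hloc (hρ.contDiff.of_le (by simp)) x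
  have he : (fun x => ∫ t, ρ (x - t) • w t) = convolution w ρ (ContinuousLinearMap.mul ℝ ℝ) := by
    ext x
    simp [convolution, mul_comm]
  have htest : IsTest Set.univ (fun t => ρ (x - t)) :=
    { contDiff := hρ.contDiff.comp (contDiff_const.sub contDiff_id)
      hasCompactSupport := hρ.hasCompactSupport.comp_homeomorph (Homeomorph.subLeft x)
      tsupport_subset := Set.subset_univ _ }
  have hg : ∀ t, gradient (fun t => ρ (x - t)) t = - gradient ρ (x - t) := by
    intro t
    have h1 : HasFDerivAt (fun t => ρ (x - t))
        (fderiv ℝ ρ (x - t) ∘L (-ContinuousLinearMap.id ℝ _)) t :=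
      ((hρ.contDiff.differentiableAt_infty _).hasFDerivAt).comp t ((hasFDerivAt_id t).const_sub x)
    rw [gradient, h1.fderiv, gradient, ← map_neg]
    congr 1
    ext v
    simp
  have := h _ htest
  simp only [hg, ContinuousLinearMap.lsmul_apply, smul_neg, integral_neg, neg_inj] at this
  rw [he, gradient, hd.fderiv, ← this, convolution]
  change (InnerProductSpace.toDual ℝ (E d)).symm.toContinuousLinearEquiv _ = _
  rw [← ContinuousLinearEquiv.integral_comp_comm]
  congr 1
  ext1 t
  change (InnerProductSpace.toDual ℝ (E d)).symm _ = _
  rw [gradient, ← map_smul]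
  rfl

/-- Let `Q z` be the left side with `w` and `G` shifted by `z`. Integrated against a mollifier `ρ`,
it becomes the weak divergence identity of `σ` tested with `ρ * w`, which is smooth and, since `w`
has compact support, compactly supported. So `Q` vanishes almost everywhere, and being continuous it
vanishes at `0`. -/
theorem integral_inner_add_eq_zero_of_univ {w f : E d → ℝ} {G σ : E d → E d}
    (hw : MemLp w 2 volume) (hG : MemLp G 2 volume) (hσ : MemLp σ 2 volume)
    (hf : MemLp f 2 volume) (hwc : HasCompactSupport w)
    (h : WeakDeriv (ContinuousLinearMap.lsmul ℝ ℝ) Set.univ w G)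
    (h' : WeakDeriv (innerSL ℝ) Set.univ σ f) :
    ∫ x, (inner ℝ (G x) (σ x) + inner ℝ (w x) (f x)) = 0 := by
  set Q : E d → ℝ := fun z => (∫ x, inner ℝ (σ x) (G (x - z))) + ∫ x, inner ℝ (f x) (w (x - z))
    with hQ
  have hQ1 : Continuous fun z => ∫ x, inner ℝ (σ x) (G (x - z)) := by
    simp_rw [sub_eq_add_neg]
    exact (continuous_integral_inner_translate hG hσ).comp continuous_neg
  have hQ2 : Continuous fun z => ∫ x, inner ℝ (f x) (w (x - z)) := by
    simp_rw [sub_eq_add_neg]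
    exact (continuous_integral_inner_translate hw hf).comp continuous_neg
  have hQc : Continuous Q := hQ1.add hQ2
  have key : ∀ ρ : E d → ℝ, ContDiff ℝ ∞ ρ → HasCompactSupport ρ → ∫ z, ρ z • Q z = 0 := by
    intro ρ hρ hρc
    have hT : IsTest Set.univ ρ := ⟨hρ, hρc, Set.subset_univ _⟩
    have he : (fun x => ∫ t, ρ (x - t) • w t)
        = convolution w ρ (ContinuousLinearMap.mul ℝ ℝ) := by
      ext x
      simp [convolution, mul_comm]
    have hwρ : IsTest Set.univ (fun x => ∫ t, ρ (x - t) • w t) := by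
      rw [he]
      exact ⟨hρc.contDiff_convolution_right _ (hw.locallyIntegrable (by norm_num)) hρ,
        HasCompactSupport.convolution _ hwc hρc, Set.subset_univ _⟩
    have h1 := h' _ hwρ
    simp_rw [gradient_mollify h hw hT] at h1
    have h2 := integral_inner_mollify hG hσ hρ.continuous hρc
    have h3 := integral_inner_mollify hw hf hρ.continuous hρc
    have i1 : Integrable fun z => ρ z • ∫ x, inner ℝ (σ x) (G (x - z)) :=
      (hρ.continuous.smul hQ1).integrable_of_hasCompactSupport hρc.smul_right
    have i2 : Integrable fun z => ρ z • ∫ x, inner ℝ (f x) (w (x - z)) :=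
      (hρ.continuous.smul hQ2).integrable_of_hasCompactSupport hρc.smul_right
    simp_rw [hQ, smul_add]
    rw [integral_add i1 i2, ← h2, ← h3]
    refine (congrArg (· + _) h1).trans ?_
    rw [neg_add_eq_zero]
    congr 1
  have h0 := ae_eq_zero_of_integral_contDiff_smul_eq_zero hQc.locallyIntegrable key
  have h0' : Q = fun _ => 0 := (hQc.ae_eq_iff_eq volume continuous_const).1 h0
  have h00 := congrFun h0' 0
  simp only [hQ, sub_zero] at h00
  rw [integral_add (integrable_inner hG hσ) (integrable_inner hw hf)]
  simpa only [real_inner_comm] using h00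

end WeakDerivatives

/-! ### Green's formula on a Lipschitz domain when one factor extends by zero -/

section Green

variable {d : ℕ} {V W : Type*} [NormedAddCommGroup V] [InnerProductSpace ℝ V]
  [NormedAddCommGroup W] [InnerProductSpace ℝ W]

open scoped Manifold in
theorem exists_smooth_partition {K : Set (E d)} (hK : IsCompact K) (U : E d → Set (E d))
    (hU : ∀ x ∈ K, U x ∈ nhds x) :
    ∃ (ι : Type) (_ : Fintype ι) (c : ι → E d) (η : ι → E d → ℝ), (∀ i, c i ∈ K) ∧
      (∀ i, IsTest (U (c i)) (η i)) ∧ (∀ i y, 0 ≤ η i y) ∧ ∀ y ∈ K, ∑ i, η i y = 1 := by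
  obtain ⟨t, htK, hKt⟩ := hK.elim_nhds_subcover (fun x => interior (U x) ∩ Metric.ball x 1)
    (fun x hx => Filter.inter_mem (interior_mem_nhds.2 (hU x hx)) (Metric.ball_mem_nhds x one_pos))
  obtain ⟨f, hf⟩ := SmoothPartitionOfUnity.exists_isSubordinate 𝓘(ℝ, E d) hK.isClosed
    (fun i : t => interior (U i) ∩ Metric.ball (i : E d) 1)
    (fun i => isOpen_interior.inter Metric.isOpen_ball)
    (hKt.trans (by
      intro y hy
      simp only [Set.mem_iUnion] at hy ⊢
      obtain ⟨x, hx, hy⟩ := hy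
      exact ⟨⟨x, hx⟩, hy⟩))
  refine ⟨t, inferInstance, fun i => i, fun i => f i, fun i => htK i i.2, fun i => ?_,
    fun i y => f.nonneg i y, fun y hy => ?_⟩
  · refine ⟨(f i).contMDiff.contDiff, ?_,
      (hf i).trans (Set.inter_subset_left.trans interior_subset)⟩
    exact Metric.isCompact_of_isClosed_isBounded (isClosed_tsupport _)
      (Metric.isBounded_ball.subset ((hf i).trans Set.inter_subset_right))
  · have := f.sum_eq_one hy
    rwa [finsum_eq_sum_of_fintype] at this

open scoped Manifold in
theorem exists_test_eq_one {C Ω : Set (E d)} (hC : IsCompact C) (hΩ : IsOpen Ω) (h : C ⊆ Ω) :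
    ∃ χ : E d → ℝ, IsTest Ω χ ∧ ∀ x ∈ C, χ x = 1 ∧ gradient χ x = 0 := by
  obtain ⟨L, hL, hCL, hLΩ⟩ := exists_compact_between hC hΩ h
  obtain ⟨f, h1, h0, -⟩ := exists_contMDiffMap_one_nhds_of_subset_interior 𝓘(ℝ, E d) (n := ⊤)
    hC.isClosed hCL
  have hs : tsupport f ⊆ L := closure_minimal (fun x hx => by
    by_contra hxL
    exact hx (h0 x hxL)) hL.isClosed
  refine ⟨f, ⟨f.contMDiff.contDiff, hL.of_isClosed_subset (isClosed_tsupport _) hs,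
    hs.trans hLΩ⟩, fun x hx => ⟨h1.self_of_nhdsSet x hx, ?_⟩⟩
  have he : f =ᶠ[nhds x] fun _ => (1 : ℝ) := eventually_nhdsSet_iff_forall.1 h1 x hx
  rw [gradient, he.fderiv_eq]
  simp

/-- First order operators with symbols `B`, `B'` that are adjoint to each other and satisfy Green's
formula on the whole space. -/
structure GreenPair (B : V →L[ℝ] E d →L[ℝ] W) (B' : W →L[ℝ] E d →L[ℝ] V) : Prop where
  adjoint : ∀ a ξ b, inner ℝ (B a ξ) b = inner ℝ a (B' b ξ)
  green : ∀ a A b β, MemLp a 2 volume → MemLp A 2 volume → MemLp b 2 volume → MemLp β 2 volume →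
    HasCompactSupport a → HasCompactSupport b → WeakDeriv B Set.univ a A →
    WeakDeriv B' Set.univ b β → ∫ x, (inner ℝ (A x) (b x) + inner ℝ (a x) (β x)) = 0

/-- Both orders are needed because the two factors play different roles on `Ω`: the first has a weak
derivative only inside `Ω`, the second on the whole space. Here the field is the one that extends,
which serves density; in `greenPair_div_grad` it is the scalar function, which serves zero traces.
-/
theorem greenPair_grad_div :
    GreenPair (d := d) (ContinuousLinearMap.lsmul ℝ ℝ) (innerSL ℝ) where
  adjoint a ξ b := by
    change inner ℝ (a • ξ) b = inner ℝ a (inner ℝ b ξ)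
    rw [real_inner_smul_left, real_inner_comm, real_inner_eq_re_inner]
    simp [mul_comm]
  green _ _ _ _ ha hA hb hβ hac _ h h' := integral_inner_add_eq_zero_of_univ ha hA hb hβ hac h h'

theorem greenPair_div_grad :
    GreenPair (d := d) (innerSL ℝ) (ContinuousLinearMap.lsmul ℝ ℝ) where
  adjoint a ξ b := by
    change inner ℝ (inner ℝ a ξ) b = inner ℝ a (b • ξ)
    simp [real_inner_smul_right]
  green a A b β ha hA hb hβ _ hbc h h' := by
    rw [← integral_inner_add_eq_zero_of_univ hb hβ ha hA hbc h' h]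
    congr 1
    ext x
    rw [add_comm, real_inner_comm, real_inner_comm (A x)]

/-- A cutoff equal to `1` on `C` turns `a` into a compactly supported function differentiable on the
whole space, and neither `a` nor `A` changes where `b` and `β` live. -/
theorem GreenPair.green_of_compact {B : V →L[ℝ] E d →L[ℝ] W} {B' : W →L[ℝ] E d →L[ℝ] V}
    (hB : GreenPair B B') {Ω C : Set (E d)} (hΩ : IsOpen Ω) (hC : IsCompact C) (hCΩ : C ⊆ Ω)
    {a : E d → V} {A : E d → W} {b : E d → W} {β : E d → V}
    (ha : MemLp a 2 volume) (hA : MemLp A 2 volume) (hb : MemLp b 2 volume)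
    (hβ : MemLp β 2 volume) (hb0 : ∀ x ∉ C, b x = 0) (hβ0 : ∀ x ∉ C, β x = 0)
    (h : WeakDeriv B Ω a A) (h' : WeakDeriv B' Set.univ b β) :
    ∫ x, (inner ℝ (A x) (b x) + inner ℝ (a x) (β x)) = 0 := by
  obtain ⟨χ, hχ, hχ1⟩ := exists_test_eq_one hC hΩ hCΩ
  have h1 := h.smul (O' := Set.univ) ha hA hχ.contDiff hχ.hasCompactSupport
    (fun φ hφ => hχ.mul_left hφ.contDiff)
  have := hB.green _ _ b β (memLp_smul ha hχ.contDiff.continuous hχ.hasCompactSupport)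
    ((memLp_smul hA hχ.contDiff.continuous hχ.hasCompactSupport).add
      (memLp_bilin B ha (continuous_gradient hχ.contDiff)
        (hasCompactSupport_gradient hχ.hasCompactSupport))) hb hβ
    hχ.hasCompactSupport.smul_right (HasCompactSupport.intro hC hb0) h1 h'
  rw [← this]
  congr 1
  ext x
  by_cases hx : x ∈ C
  · simp [hχ1 x hx]
  · simp [hb0 x hx, hβ0 x hx]

/-- The segment property: near every point of its closure, the set can be moved into itself. -/
def SegmentProperty (Ω : Set (E d)) : Prop :=
  ∀ x ∈ closure Ω, ∃ e : E d, ∃ N ∈ nhds x, ∃ s₀ : ℝ, 0 < s₀ ∧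
    ∀ y ∈ N, y ∈ closure Ω → ∀ s : ℝ, 0 < s → s < s₀ → y - s • e ∈ Ω

/-- Shifting `b` and `β` by `-s • e` moves their support into a compact subset of `Ω`, where the
previous case applies; then `s → 0` by continuity of translations. -/
theorem GreenPair.green_of_local {B : V →L[ℝ] E d →L[ℝ] W} {B' : W →L[ℝ] E d →L[ℝ] V}
    (hB : GreenPair B B') {Ω C : Set (E d)} (hΩ : IsOpen Ω) (hC : IsCompact C)
    {e : E d} {s₀ : ℝ} (hs₀ : 0 < s₀) (hin : ∀ y ∈ C, ∀ s : ℝ, 0 < s → s < s₀ → y - s • e ∈ Ω)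
    {a : E d → V} {A : E d → W} {b : E d → W} {β : E d → V}
    (ha : MemLp a 2 volume) (hA : MemLp A 2 volume) (hb : MemLp b 2 volume)
    (hβ : MemLp β 2 volume) (hb0 : ∀ x ∉ C, b x = 0) (hβ0 : ∀ x ∉ C, β x = 0)
    (h : WeakDeriv B Ω a A) (h' : WeakDeriv B' Set.univ b β) :
    ∫ x, (inner ℝ (A x) (b x) + inner ℝ (a x) (β x)) = 0 := by
  set I : ℝ → ℝ := fun s =>
    (∫ x, inner ℝ (A x) (b (x + s • e))) + ∫ x, inner ℝ (a x) (β (x + s • e)) with hI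
  have hIc : Continuous I := by
    have hl : Continuous fun s : ℝ => s • e := by fun_prop
    exact ((continuous_integral_inner_translate hb hA).comp hl).add
      ((continuous_integral_inner_translate hβ ha).comp hl)
  have hm : ∀ s : ℝ, MeasurePreserving (fun x : E d => x + s • e) volume volume :=
    fun s => measurePreserving_add_right _ _
  have hI0 : ∀ s, 0 < s → s < s₀ → I s = 0 := by
    intro s hs hs'
    have hbs : MemLp (fun x => b (x + s • e)) 2 volume := hb.comp_measurePreserving (hm s)
    have hβs : MemLp (fun x => β (x + s • e)) 2 volume := hβ.comp_measurePreserving (hm s)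
    rw [hI]
    beta_reduce
    rw [← integral_add (integrable_inner hA hbs) (integrable_inner ha hβs)]
    have hmem : ∀ x, x ∉ (fun y => y - s • e) '' C → x + s • e ∉ C :=
      fun x hx hxC => hx ⟨_, hxC, by simp⟩
    refine hB.green_of_compact hΩ (hC.image (f := fun y => y - s • e) (by fun_prop)) ?_ ha hA
      hbs hβs (fun x hx => hb0 _ (hmem x hx)) (fun x hx => hβ0 _ (hmem x hx)) h (h'.comp_add _)
    rintro _ ⟨y, hy, rfl⟩
    exact hin y hy s hs hs'
  have h0 : I 0 = 0 := by
    refine tendsto_nhds_unique ((hIc.tendsto 0).mono_left nhdsWithin_le_nhds)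
      (tendsto_const_nhds.congr' ?_ : Filter.Tendsto I (nhdsWithin 0 (Set.Ioi 0)) (nhds 0))
    filter_upwards [Ioo_mem_nhdsGT hs₀] with s hs
    exact (hI0 s hs.1 hs.2).symm
  rw [integral_add (integrable_inner hA hb) (integrable_inner ha hβ)]
  simpa [hI] using h0

/-- The factor `b` is cut into pieces by a partition of unity, each piece having its own inward
direction. The extra terms carrying `gradient (η i)` cancel in the sum, since the `η i` add up to
`1` near every point of `Ω`. -/
theorem GreenPair.green_of_extends {B : V →L[ℝ] E d →L[ℝ] W} {B' : W →L[ℝ] E d →L[ℝ] V}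
    (hB : GreenPair B B') {Ω : Set (E d)} (hΩ : IsOpen Ω) (hΩb : Bornology.IsBounded Ω)
    (hseg : SegmentProperty Ω)
    {a : E d → V} {A : E d → W} {b : E d → W} {β : E d → V}
    (ha : MemLp a 2 volume) (hA : MemLp A 2 volume) (hb : MemLp b 2 volume)
    (hβ : MemLp β 2 volume) (hb0 : ∀ x ∉ Ω, b x = 0) (hβ0 : ∀ x ∉ Ω, β x = 0)
    (h : WeakDeriv B Ω a A) (h' : WeakDeriv B' Set.univ b β) :
    ∫ x, (inner ℝ (A x) (b x) + inner ℝ (a x) (β x)) = 0 := by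
  choose! e N hN s₀ hs₀ hin using hseg
  have hK : IsCompact (closure Ω) := hΩb.isCompact_closure
  obtain ⟨ι, _, c, η, hc, hη, -, hsum⟩ := exists_smooth_partition hK N hN
  have hbi : ∀ i, MemLp (fun x => η i x • b x) 2 volume := fun i =>
    memLp_smul hb (hη i).contDiff.continuous (hη i).hasCompactSupport
  have hβi : ∀ i, MemLp (fun x => η i x • β x + B' (b x) (gradient (η i) x)) 2 volume := fun i =>
    (memLp_smul hβ (hη i).contDiff.continuous (hη i).hasCompactSupport).add
      (memLp_bilin B' hb (continuous_gradient (hη i).contDiff)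
        (hasCompactSupport_gradient (hη i).hasCompactSupport))
  have hi : ∀ i, ∫ x, (inner ℝ (A x) (η i x • b x) +
      inner ℝ (a x) (η i x • β x + B' (b x) (gradient (η i) x))) = 0 := by
    intro i
    have hz : ∀ x ∉ tsupport (η i) ∩ closure Ω, x ∉ tsupport (η i) ∨ x ∉ Ω := by
      intro x hx
      by_contra! hcon
      exact hx ⟨hcon.1, subset_closure hcon.2⟩
    refine hB.green_of_local hΩ (hK.inter_left (isClosed_tsupport (η i))) (hs₀ (c i) (hc i))
      (fun y hy => hin (c i) (hc i) y ((hη i).tsupport_subset hy.1) hy.2) ha hA (hbi i) (hβi i)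
      (fun x hx => ?_) (fun x hx => ?_) h
      (h'.smul hb hβ (hη i).contDiff (hη i).hasCompactSupport
        (fun φ hφ => hφ.mul (hη i).contDiff))
    · rcases hz x hx with h1 | h1
      · simp [image_eq_zero_of_notMem_tsupport h1]
      · simp [hb0 x h1]
    · rcases hz x hx with h1 | h1
      · have : gradient (η i) x = 0 := by
          by_contra h2
          exact h1 (support_gradient_subset _ h2)
        simp [image_eq_zero_of_notMem_tsupport h1, this]
      · simp [hb0 x h1, hβ0 x h1]
  have hs := Finset.sum_eq_zero fun i (_ : i ∈ Finset.univ) => hi i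
  have hint : ∀ i, Integrable fun x => (inner ℝ (A x) (η i x • b x) +
      inner ℝ (a x) (η i x • β x + B' (b x) (gradient (η i) x))) := fun i =>
    (integrable_inner hA (hbi i)).add (integrable_inner ha (hβi i))
  rw [← integral_finsetSum _ fun i _ => hint i] at hs
  rw [← hs]
  congr 1
  ext x
  by_cases hx : x ∈ Ω
  · have h1 : ∑ i, η i x = 1 := hsum x (subset_closure hx)
    have h2 : ∑ i, gradient (η i) x = 0 := by
      have he : (fun y => ∑ i, η i y) =ᶠ[nhds x] fun _ => (1 : ℝ) := by
        filter_upwards [hΩ.mem_nhds hx] with y hy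
        exact hsum y (subset_closure hy)
      have := he.fderiv_eq (𝕜 := ℝ)
      rw [fderiv_fun_sum fun i _ => (hη i).contDiff.differentiableAt_infty x] at this
      simp only [gradient]
      rw [← map_sum, this]
      simp
    rw [Finset.sum_add_distrib, ← inner_sum, ← inner_sum, Finset.sum_add_distrib,
      ← Finset.sum_smul, ← Finset.sum_smul, ← map_sum, h1, h2]
    simp
  · simp [hb0 x hx, hβ0 x hx]

/-- The height of a point above the graph of `γ` in the coordinates given by `R`. -/
def height (R : E d ≃ₗᵢ[ℝ] WithLp 2 (E (d - 1) × ℝ)) (γ : E (d - 1) → ℝ) (y : E d) : ℝ :=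
  (R y).snd - γ (R y).fst

/-- The unit vector in the direction of increasing height. -/
def up (R : E d ≃ₗᵢ[ℝ] WithLp 2 (E (d - 1) × ℝ)) : E d := R.symm (WithLp.toLp 2 (0, 1))

/-- In the ball `B(x, r)`, the set `Ω` is the region below the graph of `γ`. -/
structure IsChart (Ω : Set (E d)) (x : E d) (r : ℝ) (R : E d ≃ₗᵢ[ℝ] WithLp 2 (E (d - 1) × ℝ))
    (K : NNReal) (γ : E (d - 1) → ℝ) : Prop where
  lipschitz : LipschitzWith K γ
  pos : 0 < r
  mem_iff : ∀ y ∈ Metric.ball x r, y ∈ Ω ↔ height R γ y < 0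

theorem IsBoundedLipschitzDomain.exists_isChart {Ω : Set (E d)} (h : IsBoundedLipschitzDomain Ω)
    {x : E d} (hx : x ∈ frontier Ω) : ∃ r R K γ, IsChart Ω x r R K γ := by
  obtain ⟨R, K, γ, hγ, U, hU, hUΩ⟩ := h.locally_subgraph x hx
  obtain ⟨r, hr, hrU⟩ := Metric.mem_nhds_iff.1 hU
  exact ⟨r, R, K, γ, hγ, hr, fun y hy => by rw [hUΩ y (hrU hy), height, sub_neg]⟩

section Chart

variable {Ω : Set (E d)} {x : E d} {r : ℝ} {R : E d ≃ₗᵢ[ℝ] WithLp 2 (E (d - 1) × ℝ)}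
  {K : NNReal} {γ : E (d - 1) → ℝ}

theorem norm_up : ‖up R‖ = 1 := by
  rw [up, LinearIsometryEquiv.norm_map, WithLp.prod_norm_eq_of_L2]
  simp

theorem height_add_smul_up (y : E d) (s : ℝ) :
    height R γ (y + s • up R) = height R γ y + s := by
  simp [height, up, add_sub_right_comm]

theorem lipschitzWith_fst : LipschitzWith 1 fun y : E d => (R y).fst := by
  refine LipschitzWith.of_dist_le_mul fun y z => ?_
  rw [← R.dist_map y z, NNReal.coe_one, one_mul, dist_eq_norm, dist_eq_norm, ← WithLp.sub_fst]
  exact WithLp.norm_fst_le (E (d - 1)) (R y - R z)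

theorem lipschitzWith_height (hγ : LipschitzWith K γ) : LipschitzWith (1 + K) (height R γ) := by
  have h1 : LipschitzWith 1 fun y : E d => (R y).snd := by
    refine LipschitzWith.of_dist_le_mul fun y z => ?_
    rw [← R.dist_map y z, NNReal.coe_one, one_mul, dist_eq_norm, dist_eq_norm, ← WithLp.sub_snd]
    exact WithLp.norm_snd_le (E (d - 1)) (R y - R z)
  have := h1.sub (hγ.comp (lipschitzWith_fst (R := R)))
  rwa [mul_one] at this

theorem IsChart.height_nonpos (h : IsChart Ω x r R K γ) {y : E d} (hy : y ∈ Metric.ball x r)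
    (hyΩ : y ∈ closure Ω) : height R γ y ≤ 0 := by
  have hc := (lipschitzWith_height (R := R) h.lipschitz).continuous
  by_contra! hpos
  obtain ⟨z, hz, hzΩ⟩ := mem_closure_iff.1 hyΩ _
    (Metric.isOpen_ball.inter (isOpen_lt continuous_const hc)) ⟨hy, hpos⟩
  exact absurd ((h.mem_iff z hz.1).1 hzΩ) (not_lt.2 (le_of_lt hz.2))

theorem IsChart.mem_frontier_iff (h : IsChart Ω x r R K γ) (hΩ : IsOpen Ω) {y : E d}
    (hy : y ∈ Metric.ball x r) : y ∈ frontier Ω ↔ height R γ y = 0 := by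
  rw [hΩ.frontier_eq, Set.mem_sdiff, h.mem_iff y hy, not_lt]
  refine ⟨fun hm => le_antisymm (h.height_nonpos hy hm.1) hm.2, fun h0 => ⟨?_, h0.ge⟩⟩
  have ht : Filter.Tendsto (fun s : ℝ => y + s • up R) (nhdsWithin 0 (Set.Iio 0)) (nhds y) := by
    have : Continuous fun s : ℝ => y + s • up R := by fun_prop
    simpa using (this.tendsto 0).mono_left nhdsWithin_le_nhds
  refine mem_closure_of_tendsto ht ?_
  filter_upwards [ht (Metric.isOpen_ball.mem_nhds hy), self_mem_nhdsWithin] with s hs hs0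
  rw [h.mem_iff _ hs, height_add_smul_up, h0, zero_add]
  exact hs0

end Chart

/-- Moving down by `s` in a chart lowers the height by exactly `s`, and the closure has height at
most `0`. The radius is halved so that the moved point stays in the chart. -/
theorem IsBoundedLipschitzDomain.segmentProperty {Ω : Set (E d)}
    (h : IsBoundedLipschitzDomain Ω) : SegmentProperty Ω := by
  intro x hx
  by_cases hxΩ : x ∈ Ω
  · exact ⟨0, Ω, h.isOpen.mem_nhds hxΩ, 1, one_pos, fun y hy _ s _ _ => by simpa using hy⟩
  · obtain ⟨r, R, K, γ, hch⟩ := h.exists_isChart (x := x)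
      (by rw [h.isOpen.frontier_eq]; exact ⟨hx, hxΩ⟩)
    refine ⟨up R, Metric.ball x (r / 2), Metric.ball_mem_nhds x (half_pos hch.pos), r / 2,
      half_pos hch.pos, fun y hy hyΩ s hs hs' => ?_⟩
    rw [Metric.mem_ball] at hy
    have h1 : y - s • up R ∈ Metric.ball x r := by
      rw [Metric.mem_ball]
      calc dist (y - s • up R) x ≤ dist (y - s • up R) y + dist y x := dist_triangle _ _ _
        _ < r := by
          rw [dist_eq_norm, sub_sub_cancel_left, norm_neg, norm_smul, norm_up, Real.norm_eq_abs,
            abs_of_pos hs]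
          linarith
    have h2 := hch.height_nonpos (Metric.mem_ball.2 (by linarith [hch.pos])) hyΩ
    rw [hch.mem_iff _ h1, sub_eq_add_neg, ← neg_smul, height_add_smul_up]
    linarith

end Green

/-! ### The Hilbert space `H1 Ω` and density of smooth functions -/

section Density

variable {d : ℕ} {Ω : Set (E d)}

theorem memLp_indicator {V : Type*} [NormedAddCommGroup V] (hΩ : IsOpen Ω)
    (u : Lp V 2 (volume.restrict Ω)) : MemLp (Ω.indicator u) 2 volume :=
  (memLp_indicator_iff_restrict hΩ.measurableSet).2 (Lp.memLp u)

section Extension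

variable {V W Z : Type*} [NormedAddCommGroup V] [NormedSpace ℝ V]
  [NormedAddCommGroup W] [NormedSpace ℝ W] [NormedAddCommGroup Z] [NormedSpace ℝ Z]

theorem setIntegral_bilin_indicator (hΩ : IsOpen Ω) (B : V →L[ℝ] W →L[ℝ] Z) (u : E d → V)
    (g : E d → W) : ∫ x in Ω, B (u x) (g x) = ∫ x, B (Ω.indicator u x) (g x) := by
  rw [← integral_indicator hΩ.measurableSet]
  congr 1
  ext x
  by_cases hx : x ∈ Ω <;> simp [hx]

theorem setIntegral_smul_indicator (hΩ : IsOpen Ω) (φ : E d → ℝ) (G : E d → V) :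
    ∫ x in Ω, φ x • G x = ∫ x, φ x • Ω.indicator G x :=
  setIntegral_bilin_indicator hΩ (ContinuousLinearMap.lsmul ℝ ℝ).flip G φ

end Extension

theorem inner_eq_integral_indicator {V : Type*} [NormedAddCommGroup V] [InnerProductSpace ℝ V]
    (hΩ : IsOpen Ω) (u v : Lp V 2 (volume.restrict Ω)) :
    inner ℝ u v = ∫ x, inner ℝ (Ω.indicator u x) (Ω.indicator v x) := by
  rw [L2.inner_def, ← integral_indicator hΩ.measurableSet]
  congr 1
  ext x
  by_cases hx : x ∈ Ω <;> simp [hx]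

theorem HasWeakGrad.weakDeriv (hΩ : IsOpen Ω) {u : L2 Ω} {G : L2v Ω} (h : HasWeakGrad Ω u G) :
    WeakDeriv (ContinuousLinearMap.lsmul ℝ ℝ) Ω (Ω.indicator u) (Ω.indicator G) := by
  intro φ hφ
  rw [← setIntegral_bilin_indicator hΩ, ← setIntegral_smul_indicator hΩ]
  exact h φ hφ

theorem HasWeakDiv.weakDeriv (hΩ : IsOpen Ω) {σ : L2v Ω} {f : L2 Ω} (h : HasWeakDiv Ω σ f) :
    WeakDeriv (innerSL ℝ) Ω (Ω.indicator σ) (Ω.indicator f) := by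
  intro φ hφ
  rw [← setIntegral_bilin_indicator hΩ, ← setIntegral_smul_indicator hΩ]
  refine (h φ hφ).trans ?_
  simp_rw [smul_eq_mul, mul_comm]

theorem indicator_eq_zero {V : Type*} [Zero V] (u : E d → V) : ∀ x ∉ Ω, Ω.indicator u x = 0 :=
  fun _ hx => Set.indicator_of_notMem hx u

theorem inner_grad_add_inner_eq_zero_of_grad (hΩ : IsBoundedLipschitzDomain Ω) (w : H1 Ω)
    {σ : L2v Ω} {f : L2 Ω} (hσ : HasWeakDiv Ω σ f)
    (hw : WeakDeriv (ContinuousLinearMap.lsmul ℝ ℝ) Set.univ (Ω.indicator (fn w))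
      (Ω.indicator (grad w))) :
    inner ℝ (grad w) σ + inner ℝ (fn w) f = 0 := by
  have hO := hΩ.isOpen
  have := greenPair_div_grad.green_of_extends hO hΩ.isBounded hΩ.segmentProperty
    (memLp_indicator hO σ) (memLp_indicator hO f) (memLp_indicator hO (fn w))
    (memLp_indicator hO (grad w)) (indicator_eq_zero _) (indicator_eq_zero _) (hσ.weakDeriv hO) hw
  rw [integral_add (integrable_inner (memLp_indicator hO _) (memLp_indicator hO _))
    (integrable_inner (memLp_indicator hO _) (memLp_indicator hO _)),
    ← inner_eq_integral_indicator hO, ← inner_eq_integral_indicator hO] at this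
  rwa [real_inner_comm, real_inner_comm f, add_comm]

theorem inner_grad_add_inner_eq_zero_of_div (hΩ : IsBoundedLipschitzDomain Ω) (w : H1 Ω)
    {σ : L2v Ω} {f : L2 Ω}
    (hσ : WeakDeriv (innerSL ℝ) Set.univ (Ω.indicator σ) (Ω.indicator f)) :
    inner ℝ (grad w) σ + inner ℝ (fn w) f = 0 := by
  have hO := hΩ.isOpen
  have := greenPair_grad_div.green_of_extends hO hΩ.isBounded hΩ.segmentProperty
    (memLp_indicator hO (fn w)) (memLp_indicator hO (grad w)) (memLp_indicator hO σ)
    (memLp_indicator hO f) (indicator_eq_zero _) (indicator_eq_zero _)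
    (HasWeakGrad.weakDeriv hO w.2) hσ
  rwa [integral_add (integrable_inner (memLp_indicator hO _) (memLp_indicator hO _))
    (integrable_inner (memLp_indicator hO _) (memLp_indicator hO _)),
    ← inner_eq_integral_indicator hO, ← inner_eq_integral_indicator hO] at this

theorem continuous_integral_bilin {V W Z : Type*} [NormedAddCommGroup V] [NormedSpace ℝ V]
    [NormedAddCommGroup W] [NormedSpace ℝ W] [NormedAddCommGroup Z] [NormedSpace ℝ Z]
    [CompleteSpace Z] {μ : Measure (E d)} (B : V →L[ℝ] W →L[ℝ] Z) {g : E d → W}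
    (hg : MemLp g 2 μ) : Continuous fun u : Lp V 2 μ => ∫ x, B (u x) (g x) ∂μ := by
  have h : (fun u : Lp V 2 μ => ∫ x, B (u x) (g x) ∂μ) =
      fun u => B.lpPairing μ 2 2 u (hg.toLp g) := by
    ext1 u
    rw [ContinuousLinearMap.lpPairing_eq_integral]
    refine integral_congr_ae ?_
    filter_upwards [hg.coeFn_toLp] with x hx
    rw [hx]
  rw [h]
  fun_prop

/-- Closedness gives completeness, which is what allows density to be tested on the orthogonal
complement. -/
theorem isClosed_H1 : IsClosed (H1 Ω : Set (WithLp 2 (L2 Ω × L2v Ω))) := by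
  have : (H1 Ω : Set (WithLp 2 (L2 Ω × L2v Ω))) = ⋂ (φ : E d → ℝ) (_ : IsTest Ω φ),
      {w | ∫ x in Ω, w.fst x • gradient φ x = -∫ x in Ω, φ x • w.snd x} := by
    ext w
    simp only [Set.mem_iInter]
    rfl
  rw [this]
  refine isClosed_iInter fun φ => isClosed_iInter fun hφ => isClosed_eq ?_ ?_
  · exact (continuous_integral_bilin (ContinuousLinearMap.lsmul ℝ ℝ) hφ.memLp_gradient).comp
      (WithLp.continuous_fst 2 _ _)
  · exact ((continuous_integral_bilin (ContinuousLinearMap.lsmul ℝ ℝ).flip hφ.memLp).comp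
      (WithLp.continuous_snd 2 _ _)).neg

instance : CompleteSpace (H1 Ω) := isClosed_H1.completeSpace_coe

theorem IsTest.memLp_of_univ {φ : E d → ℝ} (h : IsTest Set.univ φ) (μ : Measure (E d))
    [IsFiniteMeasureOnCompacts μ] : MemLp φ 2 μ :=
  h.contDiff.continuous.memLp_of_hasCompactSupport h.hasCompactSupport

theorem IsTest.memLp_gradient_of_univ {φ : E d → ℝ} (h : IsTest Set.univ φ) (μ : Measure (E d))
    [IsFiniteMeasureOnCompacts μ] : MemLp (gradient φ) 2 μ :=
  (continuous_gradient h.contDiff).memLp_of_hasCompactSupport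
    (hasCompactSupport_gradient h.hasCompactSupport)

theorem integral_gradient_eq_zero {F : E d → ℝ} (hF : IsTest Set.univ F) :
    ∫ x, gradient F x = 0 := by
  have hi : Integrable (gradient F) :=
    (continuous_gradient hF.contDiff).integrable_of_hasCompactSupport
      (hasCompactSupport_gradient hF.hasCompactSupport)
  refine ext_inner_right ℝ fun v => ?_
  rw [inner_zero_left, real_inner_comm, ← integral_inner hi]
  simp_rw [fun x => (real_inner_comm v (gradient F x)).symm.trans (inner_gradient x v)]
  have hi' : Integrable fun x => fderiv ℝ F x v := by
    simpa [inner_gradient] using hi.inner_const (𝕜 := ℝ) v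
  have := integral_mul_fderiv_eq_neg_fderiv_mul_of_integrable (μ := volume)
    (f := fun _ : E d => (1 : ℝ)) (g := F) (v := v) (by simp) (by simpa using hi')
    (by simpa using hF.contDiff.continuous.integrable_of_hasCompactSupport hF.hasCompactSupport)
    (fun _ _ => by fun_prop) (fun x _ => hF.contDiff.differentiableAt_infty x)
  simpa using this

theorem setIntegral_gradient_eq {F : E d → ℝ} (hF : tsupport F ⊆ Ω) :
    ∫ x in Ω, gradient F x = ∫ x, gradient F x :=
  setIntegral_eq_integral_of_forall_compl_eq_zero fun x hx => by
    by_contra h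
    exact hx (hF (support_gradient_subset F h))

theorem setIntegral_smul_gradient {φ ψ : E d → ℝ} (hφ : ContDiff ℝ ∞ φ) (hψ : IsTest Ω ψ) :
    ∫ x in Ω, φ x • gradient ψ x = -∫ x in Ω, ψ x • gradient φ x := by
  have hT : IsTest Ω (fun x => φ x * ψ x) := hψ.mul hφ
  have h0 : ∫ x in Ω, gradient (fun x => φ x * ψ x) x = 0 := by
    rw [setIntegral_gradient_eq hT.tsupport_subset, integral_gradient_eq_zero
      ⟨hT.contDiff, hT.hasCompactSupport, Set.subset_univ _⟩]
  simp_rw [fun x => gradient_mul (hφ.differentiableAt_infty x)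
    (hψ.contDiff.differentiableAt_infty x)] at h0
  rw [integral_add, ← eq_neg_iff_add_eq_zero] at h0
  · exact h0
  · exact ((hφ.continuous.smul (continuous_gradient hψ.contDiff)).integrable_of_hasCompactSupport
      (hasCompactSupport_gradient hψ.hasCompactSupport).smul_left).integrableOn
  · exact ((hψ.contDiff.continuous.smul (continuous_gradient hφ)).integrable_of_hasCompactSupport
      hψ.hasCompactSupport.smul_right).integrableOn

/-- The restriction to `Ω` of a smooth compactly supported function, as an element of `H¹(Ω)`. -/
def ofTest (Ω : Set (E d)) {φ : E d → ℝ} (hφ : IsTest Set.univ φ) : H1 Ω :=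
  ⟨WithLp.toLp 2 ((hφ.memLp_of_univ (volume.restrict Ω)).toLp φ,
    (hφ.memLp_gradient_of_univ (volume.restrict Ω)).toLp (gradient φ)), by
    intro ψ hψ
    have h1 : ∫ x in Ω, (hφ.memLp_of_univ (volume.restrict Ω)).toLp φ x • gradient ψ x =
        ∫ x in Ω, φ x • gradient ψ x := by
      refine integral_congr_ae ?_
      filter_upwards [(hφ.memLp_of_univ (volume.restrict Ω)).coeFn_toLp] with x hx
      rw [hx]
    have h2 : ∫ x in Ω, ψ x • (hφ.memLp_gradient_of_univ (volume.restrict Ω)).toLp (gradient φ) x =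
        ∫ x in Ω, ψ x • gradient φ x := by
      refine integral_congr_ae ?_
      filter_upwards [(hφ.memLp_gradient_of_univ (volume.restrict Ω)).coeFn_toLp] with x hx
      rw [hx]
    exact h1.trans ((setIntegral_smul_gradient hφ.contDiff hψ).trans (congrArg _ h2.symm))⟩

theorem fn_ofTest {φ : E d → ℝ} (hφ : IsTest Set.univ φ) :
    fn (ofTest Ω hφ) =ᵐ[volume.restrict Ω] φ :=
  (hφ.memLp_of_univ (volume.restrict Ω)).coeFn_toLp

theorem grad_ofTest {φ : E d → ℝ} (hφ : IsTest Set.univ φ) :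
    grad (ofTest Ω hφ) =ᵐ[volume.restrict Ω] gradient φ :=
  (hφ.memLp_gradient_of_univ (volume.restrict Ω)).coeFn_toLp

theorem inner_H1 (w z : H1 Ω) : inner ℝ w z = inner ℝ (fn w) (fn z) + inner ℝ (grad w) (grad z) :=
  rfl

theorem norm_sq_H1 (w : H1 Ω) : ‖w‖ ^ 2 = ‖fn w‖ ^ 2 + ‖grad w‖ ^ 2 := by
  rw [← real_inner_self_eq_norm_sq, inner_H1, real_inner_self_eq_norm_sq,
    real_inner_self_eq_norm_sq]

theorem grad_ae_eq_gradient (hΩ : IsOpen Ω) {w : H1 Ω} {φ : E d → ℝ} (hφ : ContDiff ℝ ∞ φ)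
    (h : fn w =ᵐ[volume.restrict Ω] φ) : grad w =ᵐ[volume.restrict Ω] gradient φ := by
  have hl : LocallyIntegrableOn (fun x => (grad w) x - gradient φ x) Ω := by
    refine LocallyIntegrableOn.sub ?_
      ((continuous_gradient hφ).locallyIntegrable.locallyIntegrableOn _)
    exact locallyIntegrableOn_of_locallyIntegrable_restrict
      ((Lp.memLp (grad w)).locallyIntegrable (by norm_num))
  have := hΩ.ae_eq_zero_of_integral_contDiff_smul_eq_zero hl ?_
  · filter_upwards [(ae_restrict_iff' hΩ.measurableSet).2 this] with x hx
    exact sub_eq_zero.1 hx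
  intro ψ hψ hψc hψs
  have hT : IsTest Ω ψ := ⟨hψ, hψc, hψs⟩
  have h1 := w.2 ψ hT
  have h2 : ∫ x in Ω, (fn w) x • gradient ψ x = ∫ x in Ω, φ x • gradient ψ x := by
    refine integral_congr_ae ?_
    filter_upwards [h] with x hx
    rw [hx]
  have h3 := h2.symm.trans h1
  rw [setIntegral_smul_gradient hφ hT, neg_inj] at h3
  rw [← setIntegral_eq_integral_of_forall_compl_eq_zero (s := Ω) (fun x hx => by
    rw [image_eq_zero_of_notMem_tsupport (fun hh => hx (hψs hh)), zero_smul])]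
  simp_rw [smul_sub]
  rw [integral_sub, sub_eq_zero, h3]
  · rfl
  · exact integrable_smul_of_memLp hT.memLp (Lp.memLp _)
  · exact ((hψ.continuous.smul (continuous_gradient hφ)).integrable_of_hasCompactSupport
      hψc.smul_right).integrableOn

/-- Restrictions of smooth compactly supported functions are dense in `H¹(Ω)`. -/
theorem dense_span_ofTest (hΩ : IsBoundedLipschitzDomain Ω) :
    (Submodule.span ℝ {w : H1 Ω | ∃ (φ : E d → ℝ) (hφ : IsTest Set.univ φ),
      w = ofTest Ω hφ}).topologicalClosure = ⊤ := by
  rw [Submodule.topologicalClosure_eq_top_iff, Submodule.eq_bot_iff]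
  intro w hw
  have hO := hΩ.isOpen
  have h : ∀ (φ : E d → ℝ) (hφ : IsTest Set.univ φ), inner ℝ (ofTest Ω hφ) w = 0 :=
    fun φ hφ => hw _ (Submodule.subset_span ⟨φ, hφ, rfl⟩)
  -- Orthogonality to all smooth functions, not only those vanishing near the boundary, says that
  -- `grad w` extended by zero has divergence `fn w` extended by zero. Pairing this field with `w`
  -- itself gives `‖w‖² = 0`.
  have hdiv : WeakDeriv (innerSL ℝ) Set.univ (Ω.indicator (grad w)) (Ω.indicator (fn w)) := by
    intro φ hφ
    have h1 := h φ hφ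
    rw [inner_H1, L2.inner_def, L2.inner_def] at h1
    rw [← setIntegral_bilin_indicator hO, ← setIntegral_smul_indicator hO]
    rw [eq_neg_iff_add_eq_zero, add_comm, ← h1]
    congr 1
    · refine integral_congr_ae ?_
      filter_upwards [fn_ofTest (Ω := Ω) hφ] with x hx
      rw [hx]
      simp [mul_comm]
    · refine integral_congr_ae ?_
      filter_upwards [grad_ofTest (Ω := Ω) hφ] with x hx
      rw [hx, real_inner_comm]
      rfl
  have h0 := inner_grad_add_inner_eq_zero_of_div hΩ w hdiv
  rw [add_comm, ← inner_H1] at h0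
  exact inner_self_eq_zero.1 h0

end Density

/-! ### The surface measure and integration in graph coordinates -/

section Graph

variable {d : ℕ} {Ω : Set (E d)}

theorem euclideanHausdorffMeasure_image_le {X Y : Type*} [EMetricSpace X] [MeasurableSpace X]
    [BorelSpace X] [EMetricSpace Y] [MeasurableSpace Y] [BorelSpace Y] {K : NNReal} {f : X → Y}
    (hf : LipschitzWith K f) (n : ℕ) (s : Set X) :
    Measure.euclideanHausdorffMeasure n (f '' s) ≤
      (K : ENNReal) ^ n * Measure.euclideanHausdorffMeasure n s := by
  have := hf.hausdorffMeasure_image_le (d := n) (by positivity) s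
  rw [ENNReal.rpow_natCast] at this
  rw [Measure.euclideanHausdorffMeasure_def, Measure.euclideanHausdorffMeasure_def,
    Measure.smul_apply, Measure.smul_apply, ENNReal.smul_def, ENNReal.smul_def, smul_eq_mul,
    smul_eq_mul, mul_left_comm]
  exact mul_le_mul_right this _

section Chart

variable {x : E d} {r : ℝ} {R : E d ≃ₗᵢ[ℝ] WithLp 2 (E (d - 1) × ℝ)}
  {K : NNReal} {γ : E (d - 1) → ℝ}

/-- The parametrisation of the graph of `γ`. -/
def graphMap (R : E d ≃ₗᵢ[ℝ] WithLp 2 (E (d - 1) × ℝ)) (γ : E (d - 1) → ℝ) (z : E (d - 1)) : E d :=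
  R.symm (WithLp.toLp 2 (z, γ z))

/-- Coordinates adapted to the graph of `γ`: position along the graph, and height. -/
def chartMap (R : E d ≃ₗᵢ[ℝ] WithLp 2 (E (d - 1) × ℝ)) (γ : E (d - 1) → ℝ) (p : E (d - 1) × ℝ) :
    E d :=
  graphMap R γ p.1 + p.2 • up R

theorem chartMap_eq (p : E (d - 1) × ℝ) :
    chartMap R γ p = R.symm (WithLp.toLp 2 (p.1, γ p.1 + p.2)) := by
  rw [chartMap, graphMap, up, ← map_smul, ← map_add]
  congr 1
  rw [← WithLp.toLp_smul, ← WithLp.toLp_add]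
  simp

theorem fst_graphMap (z : E (d - 1)) : (R (graphMap R γ z)).fst = z := by
  simp [graphMap]

theorem height_graphMap (z : E (d - 1)) : height R γ (graphMap R γ z) = 0 := by
  simp [graphMap, height]

theorem height_chartMap (p : E (d - 1) × ℝ) : height R γ (chartMap R γ p) = p.2 := by
  rw [chartMap, height_add_smul_up, height_graphMap, zero_add]

theorem graphMap_fst {y : E d} (hy : height R γ y = 0) : graphMap R γ (R y).fst = y := by
  rw [height, sub_eq_zero] at hy
  rw [graphMap, ← hy]
  exact R.symm_apply_apply y

theorem lipschitzWith_graphMap (hγ : LipschitzWith K γ) :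
    LipschitzWith (1 + K) (graphMap R γ) := by
  refine LipschitzWith.of_dist_le_mul fun y z => ?_
  rw [graphMap, graphMap, LinearIsometryEquiv.dist_map, dist_eq_norm, ← WithLp.toLp_sub,
    WithLp.prod_norm_eq_of_L2]
  have h1 := hγ.dist_le_mul y z
  rw [dist_eq_norm, dist_eq_norm] at h1
  refine Real.sqrt_le_iff.2 ⟨by positivity, ?_⟩
  change ‖y - z‖ ^ 2 + ‖γ y - γ z‖ ^ 2 ≤ _
  rw [NNReal.coe_add, NNReal.coe_one, dist_eq_norm]
  nlinarith [norm_nonneg (y - z), norm_nonneg (γ y - γ z), K.2,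
    mul_nonneg K.2 (sq_nonneg ‖y - z‖), mul_nonneg K.2 (norm_nonneg (y - z))]

theorem antilipschitzWith_graphMap : AntilipschitzWith 1 (graphMap R γ) := by
  refine AntilipschitzWith.of_le_mul_dist fun y z => ?_
  simpa [fst_graphMap] using
    (lipschitzWith_fst (R := R)).dist_le_mul (graphMap R γ y) (graphMap R γ z)

theorem isClosedEmbedding_graphMap (hγ : LipschitzWith K γ) :
    Topology.IsClosedEmbedding (graphMap R γ) :=
  antilipschitzWith_graphMap.isClosedEmbedding (lipschitzWith_graphMap hγ).uniformContinuous

/-- The map is a vertical shear followed by an isometry. -/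
theorem measurePreserving_chartMap (hγ : Continuous γ) :
    MeasurePreserving (chartMap R γ) (volume.prod volume) volume := by
  have h1 : MeasurePreserving (fun p : E (d - 1) × ℝ => (id p.1, γ p.1 + p.2))
      (volume.prod volume) (volume.prod volume) :=
    (MeasurePreserving.id volume).skew_product
      (g := fun z t => γ z + t) (by unfold Function.uncurry; fun_prop)
      (Filter.Eventually.of_forall fun z => (measurePreserving_add_left volume (γ z)).map_eq)
  have h2 := (R.symm.measurePreserving).comp
    ((WithLp.volume_preserving_toLp (E (d - 1)) ℝ).comp h1)
  rw [show chartMap R γ = _ from funext chartMap_eq]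
  exact h2

/-- Inside the chart the boundary is a Lipschitz image of the parameter space, and Hausdorff measure
grows by at most the Lipschitz constant to the power `d - 1`. The reverse comparison below uses that
the projection back is `1`-Lipschitz. These two bounds suffice, so no area formula enters. -/
theorem IsChart.surface_restrict_le (h : IsChart Ω x r R K γ) (hΩ : IsOpen Ω) :
    (surface Ω).restrict (Metric.ball x r) ≤
      ((1 + K) ^ (d - 1) : NNReal) • (volume : Measure (E (d - 1))).map (graphMap R γ) := by
  have hc := (lipschitzWith_graphMap (R := R) h.lipschitz).continuous
  refine Measure.le_iff.2 fun A hA => ?_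
  rw [Measure.restrict_apply hA, surface, Measure.restrict_apply (hA.inter measurableSet_ball),
    Measure.smul_apply, Measure.map_apply hc.measurable hA,
    ← EuclideanSpace.euclideanHausdorffMeasure_eq_volume]
  refine (measure_mono ?_).trans ((euclideanHausdorffMeasure_image_le
    (lipschitzWith_graphMap (R := R) h.lipschitz) (d - 1) (graphMap R γ ⁻¹' A)).trans_eq ?_)
  · rintro y ⟨⟨hyA, hyb⟩, hyf⟩
    have := graphMap_fst ((h.mem_frontier_iff hΩ hyb).1 hyf)
    exact ⟨(R y).fst, by rwa [Set.mem_preimage, this], this⟩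
  · rw [ENNReal.smul_def, smul_eq_mul, ENNReal.coe_pow]

theorem IsChart.map_graphMap_restrict_le (h : IsChart Ω x r R K γ) (hΩ : IsOpen Ω) :
    ((volume : Measure (E (d - 1))).map (graphMap R γ)).restrict (Metric.ball x r) ≤
      surface Ω := by
  have hc := (lipschitzWith_graphMap (R := R) h.lipschitz).continuous
  refine Measure.le_iff.2 fun A hA => ?_
  rw [Measure.restrict_apply hA, surface, Measure.restrict_apply hA,
    Measure.map_apply hc.measurable (hA.inter measurableSet_ball),
    ← EuclideanSpace.euclideanHausdorffMeasure_eq_volume]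
  refine (measure_mono ?_).trans ((euclideanHausdorffMeasure_image_le
    (lipschitzWith_fst (R := R)) (d - 1) (A ∩ frontier Ω)).trans_eq (by simp))
  rintro z ⟨hzA, hzb⟩
  exact ⟨graphMap R γ z, ⟨hzA, (h.mem_frontier_iff hΩ hzb).2 (height_graphMap z)⟩, fst_graphMap z⟩

theorem isFiniteMeasure_surface (hΩ : IsBoundedLipschitzDomain Ω) :
    IsFiniteMeasure (surface Ω) := by
  have hK : IsCompact (frontier Ω) :=
    hΩ.isBounded.isCompact_closure.of_isClosed_subset isClosed_frontier frontier_subset_closure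
  have hlt : surface Ω (frontier Ω) < ⊤ := by
    refine hK.measure_lt_top_of_nhdsWithin fun x hx => ?_
    obtain ⟨r, R, K, γ, h⟩ := hΩ.exists_isChart hx
    refine ⟨Metric.ball x r, mem_nhdsWithin_of_mem_nhds (Metric.ball_mem_nhds x h.pos), ?_⟩
    have h1 := h.surface_restrict_le hΩ.isOpen (Metric.ball x r)
    rw [Measure.restrict_apply_self] at h1
    refine h1.trans_lt ?_
    have hc := (lipschitzWith_graphMap (R := R) h.lipschitz).continuous
    rw [Measure.smul_apply, Measure.map_apply hc.measurable measurableSet_ball, ENNReal.smul_def,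
      smul_eq_mul]
    refine ENNReal.mul_lt_top ENNReal.coe_lt_top ?_
    exact (antilipschitzWith_graphMap.isBounded_preimage Metric.isBounded_ball).measure_lt_top
  refine ⟨?_⟩
  rw [surface, Measure.restrict_apply_univ]
  rwa [surface, Measure.restrict_apply_self] at hlt

theorem integrable_comp_graphMap (hγ : LipschitzWith K γ) {F : E d → ℝ} (hF : Continuous F)
    (hFc : HasCompactSupport F) : Integrable fun z => F (graphMap R γ z) :=
  (hF.comp (lipschitzWith_graphMap hγ).continuous).integrable_of_hasCompactSupport
    (hFc.comp_isClosedEmbedding (isClosedEmbedding_graphMap hγ))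

theorem IsChart.integral_surface_le (h : IsChart Ω x r R K γ) (hΩ : IsOpen Ω) {F : E d → ℝ}
    (hF : Continuous F) (hFc : HasCompactSupport F) (hFs : tsupport F ⊆ Metric.ball x r)
    (hF0 : ∀ y, 0 ≤ F y) :
    ∫ y, F y ∂(surface Ω) ≤ (1 + K) ^ (d - 1) * ∫ z, F (graphMap R γ z) := by
  have hc := (lipschitzWith_graphMap (R := R) h.lipschitz).continuous
  have hi : Integrable F ((volume : Measure (E (d - 1))).map (graphMap R γ)) :=
    (integrable_map_measure hF.aestronglyMeasurable hc.measurable.aemeasurable).2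
      (integrable_comp_graphMap h.lipschitz hF hFc)
  have h1 := integral_mono_measure (h.surface_restrict_le hΩ)
    (Filter.Eventually.of_forall hF0) (hi.smul_measure_nnreal)
  rw [integral_smul_nnreal_measure, integral_map hc.measurable.aemeasurable
    hF.aestronglyMeasurable, setIntegral_eq_integral_of_forall_compl_eq_zero
    (fun y hy => image_eq_zero_of_notMem_tsupport fun hy' => hy (hFs hy'))] at h1
  simpa [NNReal.smul_def] using h1

theorem IsChart.integral_comp_graphMap_le (h : IsChart Ω x r R K γ) (hΩ : IsOpen Ω)
    [IsFiniteMeasure (surface Ω)] {F : E d → ℝ}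
    (hF : Continuous F) (hFc : HasCompactSupport F) (hFs : tsupport F ⊆ Metric.ball x r) :
    ∫ z, |F (graphMap R γ z)| ≤ ∫ y, |F y| ∂(surface Ω) := by
  have hc := (lipschitzWith_graphMap (R := R) h.lipschitz).continuous
  have hi : Integrable F (surface Ω) := hF.integrable_of_hasCompactSupport hFc
  have h1 := integral_mono_measure (h.map_graphMap_restrict_le hΩ)
    (Filter.Eventually.of_forall fun y => abs_nonneg (F y)) hi.abs
  rwa [setIntegral_eq_integral_of_forall_compl_eq_zero
    (fun y hy => by rw [image_eq_zero_of_notMem_tsupport fun hy' => hy (hFs hy'), abs_zero]),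
    integral_map hc.measurable.aemeasurable hF.abs.aestronglyMeasurable] at h1

theorem IsChart.setIntegral_eq (h : IsChart Ω x r R K γ) (hΩ : IsOpen Ω) {f : E d → ℝ}
    (hf : ∀ y ∉ Metric.ball x r, f y = 0) :
    ∫ y in Ω, f y = ∫ y, {y | height R γ y < 0}.indicator f y := by
  rw [← integral_indicator hΩ.measurableSet]
  congr 1
  ext y
  by_cases hy : y ∈ Metric.ball x r
  · simp only [Set.indicator, h.mem_iff y hy, Set.mem_ofPred_eq]
  · simp [Set.indicator, hf y hy]

theorem fderiv_eq_zero_of_notMem {F : E d → ℝ} {S : Set (E d)} (hFs : tsupport F ⊆ S) (v : E d) :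
    ∀ y ∉ S, fderiv ℝ F y v = 0 := fun y hy => by
  have : fderiv ℝ F y = 0 := by
    by_contra h0
    exact hy (hFs (support_fderiv_subset ℝ h0))
  rw [this, zero_apply]

theorem IsTest.integrable_fderiv {F : E d → ℝ} {S : Set (E d)} (hF : IsTest S F) (v : E d) :
    Integrable fun y => fderiv ℝ F y v :=
  ((hF.contDiff.continuous_fderiv (by simp)).clm_apply
    continuous_const).integrable_of_hasCompactSupport
    ((hF.hasCompactSupport.fderiv (𝕜 := ℝ)).comp_left (g := fun L : E d →L[ℝ] ℝ => L v) (by simp))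

theorem isometry_line (g : E d) : Isometry fun t : ℝ => g + t • up R := by
  refine Isometry.of_dist_eq fun s t => ?_
  rw [dist_add_left, dist_eq_norm, ← sub_smul, norm_smul, norm_up, mul_one, Real.dist_eq,
    Real.norm_eq_abs]

/-- The fundamental theorem of calculus is applied on each vertical line, from `-∞` up to the graph,
and the lines are assembled by Fubini. -/
theorem IsChart.setIntegral_fderiv_up (h : IsChart Ω x r R K γ) (hΩ : IsOpen Ω) {F : E d → ℝ}
    (hF : IsTest (Metric.ball x r) F) :
    ∫ y in Ω, fderiv ℝ F y (up R) = ∫ z, F (graphMap R γ z) := by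
  have hmeas : MeasurableSet {y | height R γ y < 0} :=
    (isOpen_lt (lipschitzWith_height h.lipschitz).continuous continuous_const).measurableSet
  have hint := (hF.integrable_fderiv (up R)).indicator hmeas
  have hmp := measurePreserving_chartMap (R := R) h.lipschitz.continuous
  have hint2 := (hmp.integrable_comp hint.aestronglyMeasurable).2 hint
  rw [h.setIntegral_eq hΩ (fderiv_eq_zero_of_notMem hF.tsupport_subset _)]
  rw [← hmp.map_eq, integral_map hmp.measurable.aemeasurable
    (by rw [hmp.map_eq]; exact hint.aestronglyMeasurable)]
  refine (integral_prod _ hint2).trans ?_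
  congr 1
  ext z
  have hcd : ContDiff ℝ 1 fun t : ℝ => F (graphMap R γ z + t • up R) :=
    (hF.contDiff.of_le (by simp)).comp
      (contDiff_const.add (contDiff_id.smul contDiff_const))
  have hcs : HasCompactSupport fun t : ℝ => F (graphMap R γ z + t • up R) :=
    hF.hasCompactSupport.comp_isClosedEmbedding (isometry_line _).isClosedEmbedding
  have h0 := hcs.integral_Iic_deriv_eq hcd 0
  rw [zero_smul, add_zero] at h0
  rw [← h0, integral_Iic_eq_integral_Iio, ← integral_indicator measurableSet_Iio]
  congr 1
  ext t
  have hd : HasDerivAt (fun t : ℝ => F (graphMap R γ z + t • up R))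
      (fderiv ℝ F (graphMap R γ z + t • up R) (up R)) t := by
    have h1 : HasDerivAt (fun t : ℝ => graphMap R γ z + t • up R) (up R) t := by
      simpa using ((hasDerivAt_id t).smul_const (up R)).const_add (graphMap R γ z)
    exact ((hF.contDiff.differentiableAt_infty _).hasFDerivAt).comp_hasDerivAt t h1
  simp only [Function.comp_apply, Set.indicator, Set.mem_ofPred_eq, height_chartMap, Set.mem_Iio,
    hd.deriv]
  rfl

end Chart

end Graph

/-! ### Boundary estimates in a chart -/

section BoundaryEstimates

variable {d : ℕ} {Ω : Set (E d)}

section Chart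

variable {x : E d} {r : ℝ} {R : E d ≃ₗᵢ[ℝ] WithLp 2 (E (d - 1) × ℝ)}
  {K : NNReal} {γ : E (d - 1) → ℝ}

theorem fst_chartMap (p : E (d - 1) × ℝ) : (R (chartMap R γ p)).fst = p.1 := by
  simp [chartMap_eq]

/-- Over the band of thickness `ε` below the graph, `F` differs from its value on the graph by at
most its Lipschitz constant times `ε`. -/
theorem exists_integral_band_le (hγ : LipschitzWith K γ) {F : E d → ℝ}
    (hF : ContDiff ℝ ∞ F) (hFc : HasCompactSupport F) :
    ∃ C : ℝ, ∀ ε : ℝ, 0 < ε → ∫ y, {y | height R γ y ∈ Set.Icc (-ε) 0}.indicator (fun y => |F y|) y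
      ≤ ε * ((∫ z, |F (graphMap R γ z)|) + ε * C) := by
  obtain ⟨L, hL⟩ := hF.lipschitzWith_of_hasCompactSupport hFc (by simp)
  set S : Set (E (d - 1)) := (fun y => (R y).fst) '' tsupport F with hS
  have hSc : IsCompact S := IsCompact.image hFc (lipschitzWith_fst (R := R)).continuous
  have hSi : Integrable (S.indicator fun _ => (L : ℝ)) :=
    (integrable_indicator_iff hSc.measurableSet).2 (integrableOn_const hSc.measure_lt_top.ne)
  -- The constant is the Lipschitz constant of `F` times the measure of the shadow `S` of its
  -- support.
  refine ⟨∫ z, S.indicator (fun _ => (L : ℝ)) z, fun ε hε => ?_⟩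
  have hmeas : MeasurableSet {y | height R γ y ∈ Set.Icc (-ε) 0} :=
    (lipschitzWith_height hγ).continuous.measurable measurableSet_Icc
  have hint := (hF.continuous.integrable_of_hasCompactSupport (μ := volume) hFc).abs.indicator hmeas
  have hmp := measurePreserving_chartMap (R := R) hγ.continuous
  have hint2 := (hmp.integrable_comp hint.aestronglyMeasurable).2 hint
  have hgi := (integrable_comp_graphMap (R := R) hγ hF.continuous hFc).abs
  rw [← hmp.map_eq, integral_map hmp.measurable.aemeasurable
    (by rw [hmp.map_eq]; exact hint.aestronglyMeasurable)]
  refine (integral_prod _ hint2).trans_le ?_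
  rw [← integral_const_mul, ← integral_add hgi (hSi.const_mul ε), ← integral_const_mul]
  refine integral_mono hint2.integral_prod_left ((hgi.add (hSi.const_mul ε)).const_mul ε)
    fun z => ?_
  have hpt : ∀ t ∈ Set.Icc (-ε) 0, ‖|F (chartMap R γ (z, t))|‖ ≤
      |F (graphMap R γ z)| + ε * S.indicator (fun _ => (L : ℝ)) z := by
    intro t ht
    rw [Real.norm_eq_abs, abs_abs]
    by_cases h0 : F (chartMap R γ (z, t)) = 0
    · rw [h0, abs_zero]
      exact add_nonneg (abs_nonneg _) (mul_nonneg hε.le (Set.indicator_nonneg (by simp) _))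
    · have hzS : z ∈ S := ⟨_, subset_tsupport _ h0, fst_chartMap (z, t)⟩
      rw [Set.indicator_of_mem hzS]
      have h1 := hL.dist_le_mul (chartMap R γ (z, t)) (graphMap R γ z)
      rw [Real.dist_eq, dist_eq_norm, chartMap, add_sub_cancel_left, norm_smul, norm_up, mul_one,
        Real.norm_eq_abs, abs_of_nonpos ht.2] at h1
      have h2 := abs_sub_abs_le_abs_sub (F (chartMap R γ (z, t))) (F (graphMap R γ z))
      have h3 : (L : ℝ) * -t ≤ L * ε := mul_le_mul_of_nonneg_left (by linarith [ht.1]) L.2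
      have h4 := h1.trans h3
      simp only [chartMap] at h2 ⊢
      linarith
  have h1 := norm_setIntegral_le_of_norm_le_const (μ := volume) (by simp) hpt
  have h2 : ∫ t, ({y | height R γ y ∈ Set.Icc (-ε) 0}.indicator (fun y => |F y|) ∘ chartMap R γ)
      (z, t) = ∫ t in Set.Icc (-ε) 0, |F (chartMap R γ (z, t))| := by
    rw [← integral_indicator measurableSet_Icc]
    congr 1
    ext t
    simp only [Function.comp_apply, Set.indicator, Set.mem_ofPred_eq, height_chartMap]
  rw [h2]
  refine (le_abs_self _).trans (h1.trans_eq ?_)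
  simp [Measure.real, hε.le, mul_comm]

/-- The clamped depth is `(1 + K)`-Lipschitz and locally constant off the band, so its derivative
lives only there. Divided by `ε`, it is a Lipschitz approximation of the indicator of the subgraph.
-/
theorem norm_lineDeriv_clamp_le (hγ : LipschitzWith K γ) {ε : ℝ} (y v : E d) :
    ‖lineDeriv ℝ (fun y => max 0 (min ε (-height R γ y))) y v‖ ≤
      {y | height R γ y ∈ Set.Icc (-ε) 0}.indicator (fun _ => (1 + K) * ‖v‖) y := by
  have hc := (lipschitzWith_height (R := R) hγ).continuous
  have hconst : ∀ c : ℝ, lineDeriv ℝ (fun _ : E d => c) y v = 0 := fun c => by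
    rw [(differentiableAt_const c).lineDeriv_eq_fderiv]
    simp
  by_cases hy : height R γ y ∈ Set.Icc (-ε) 0
  · rw [Set.indicator_of_mem (by exact hy)]
    have hl := ((lipschitzWith_height (R := R) hγ).neg.const_min ε).const_max 0
    simpa using norm_lineDeriv_le_of_lipschitz ℝ (x₀ := y) (v := v) hl
  · rw [Set.indicator_of_notMem (by exact hy)]
    rw [Set.mem_Icc, not_and_or, not_le, not_le] at hy
    have : lineDeriv ℝ (fun y => max 0 (min ε (-height R γ y))) y v = 0 := by
      rcases hy with hy | hy
      · refine (Filter.EventuallyEq.lineDeriv_eq ?_).trans (hconst (max 0 ε))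
        filter_upwards [hc.continuousAt.eventually_lt_const hy] with z hz
        rw [min_eq_left (by linarith)]
      · refine (Filter.EventuallyEq.lineDeriv_eq ?_).trans (hconst 0)
        filter_upwards [hc.continuousAt.eventually_const_lt hy] with z hz
        exact max_eq_left ((min_le_right _ _).trans (neg_nonpos.2 hz.le))
    rw [this, norm_zero]

theorem tendsto_clamp (h : ℝ) : Filter.Tendsto (fun ε : ℝ => ε⁻¹ * max 0 (min ε (-h)))
    (nhdsWithin 0 (Set.Ioi 0)) (nhds (if h < 0 then 1 else 0)) := by
  refine tendsto_const_nhds.congr' ?_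
  split_ifs with h0
  · filter_upwards [Ioo_mem_nhdsGT (neg_pos.2 h0)] with ε hε
    rw [min_eq_left hε.2.le, max_eq_right hε.1.le, inv_mul_cancel₀ hε.1.ne']
  · refine Filter.Eventually.of_forall fun ε => ?_
    change 0 = ε⁻¹ * max 0 (min ε (-h))
    rw [max_eq_left ((min_le_right _ _).trans (neg_nonpos.2 (not_lt.1 h0))), mul_zero]

/-- This inequality stands in for the divergence theorem and needs no normal vector. The indicator
of `Ω` is replaced by the clamped depth over `ε`, the derivative is moved onto it, and the band
estimate controls the result as `ε → 0`. -/
theorem IsChart.abs_setIntegral_fderiv_le (h : IsChart Ω x r R K γ) (hΩ : IsOpen Ω) {F : E d → ℝ}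
    (hF : IsTest (Metric.ball x r) F) (v : E d) :
    |∫ y in Ω, fderiv ℝ F y v| ≤ (1 + K) * ‖v‖ * ∫ z, |F (graphMap R γ z)| := by
  have hγ := h.lipschitz
  have hc := (lipschitzWith_height (R := R) hγ).continuous
  obtain ⟨C, hC⟩ := exists_integral_band_le (R := R) hγ hF.contDiff hF.hasCompactSupport
  obtain ⟨L, hL⟩ := hF.contDiff.lipschitzWith_of_hasCompactSupport hF.hasCompactSupport (by simp)
  have hFi : Integrable F := hF.contDiff.continuous.integrable_of_hasCompactSupport
    hF.hasCompactSupport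
  have hbound : ∀ ε : ℝ, 0 < ε →
      |∫ y, fderiv ℝ F y v * (ε⁻¹ * max 0 (min ε (-height R γ y)))| ≤
        (1 + K) * ‖v‖ * ((∫ z, |F (graphMap R γ z)|) + ε * C) := by
    intro ε hε
    have hl := ((lipschitzWith_height (R := R) hγ).neg.const_min ε).const_max 0
    -- Integration by parts for Lipschitz functions flips the direction, so starting from `-v` puts
    -- the derivative along `v` on `F`.
    have h1 := hl.integral_lineDeriv_mul_eq (μ := volume) hL hF.hasCompactSupport (-v)
    simp_rw [neg_neg, fun y => (hF.contDiff.differentiableAt_infty y).lineDeriv_eq_fderiv (v := v),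
      Pi.neg_apply] at h1
    have h2 : ∫ y, fderiv ℝ F y v * (ε⁻¹ * max 0 (min ε (-height R γ y))) =
        ε⁻¹ * ∫ y, lineDeriv ℝ (fun y => max 0 (min ε (-height R γ y))) y (-v) * F y := by
      rw [h1, ← integral_const_mul]
      congr 1
      ext y
      ring
    rw [h2, abs_mul, abs_of_pos (inv_pos.2 hε)]
    have hmeas : MeasurableSet {y | height R γ y ∈ Set.Icc (-ε) 0} :=
      hc.measurable measurableSet_Icc
    have h3 : |∫ y, lineDeriv ℝ (fun y => max 0 (min ε (-height R γ y))) y (-v) * F y| ≤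
        ∫ y, (1 + K) * ‖v‖ * {y | height R γ y ∈ Set.Icc (-ε) 0}.indicator (fun y => |F y|) y := by
      rw [← Real.norm_eq_abs]
      refine norm_integral_le_of_norm_le ((hFi.abs.indicator hmeas).const_mul _)
        (Filter.Eventually.of_forall fun y => ?_)
      rw [norm_mul]
      have h4 := norm_lineDeriv_clamp_le (R := R) hγ (ε := ε) y (-v)
      rw [norm_neg] at h4
      refine (mul_le_mul_of_nonneg_right h4 (norm_nonneg _)).trans_eq ?_
      by_cases hy : y ∈ {y | height R γ y ∈ Set.Icc (-ε) 0}
      · simp only [Set.indicator_of_mem hy, Real.norm_eq_abs]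
      · simp only [Set.indicator_of_notMem hy, zero_mul, mul_zero]
    rw [integral_const_mul] at h3
    have h5 : |∫ y, lineDeriv ℝ (fun y => max 0 (min ε (-height R γ y))) y (-v) * F y| ≤
        (1 + K) * ‖v‖ * (ε * ((∫ z, |F (graphMap R γ z)|) + ε * C)) :=
      h3.trans (mul_le_mul_of_nonneg_left (hC ε hε) (by positivity))
    refine (mul_le_mul_of_nonneg_left h5 (inv_pos.2 hε).le).trans_eq ?_
    field_simp
  have hlim : Filter.Tendsto
      (fun ε : ℝ => ∫ y, fderiv ℝ F y v * (ε⁻¹ * max 0 (min ε (-height R γ y))))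
      (nhdsWithin 0 (Set.Ioi 0)) (nhds (∫ y in Ω, fderiv ℝ F y v)) := by
    rw [h.setIntegral_eq hΩ (fderiv_eq_zero_of_notMem hF.tsupport_subset _)]
    refine tendsto_integral_filter_of_dominated_convergence (fun y => ‖fderiv ℝ F y v‖)
      (Filter.Eventually.of_forall fun ε => ?_) ?_ (hF.integrable_fderiv v).norm
      (Filter.Eventually.of_forall fun y => ?_)
    · exact (hF.integrable_fderiv v).1.mul (by fun_prop)
    · filter_upwards [self_mem_nhdsWithin] with ε hε
      refine Filter.Eventually.of_forall fun y => ?_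
      rw [norm_mul]
      refine mul_le_of_le_one_right (norm_nonneg _) ?_
      have hε' : (0 : ℝ) < ε := hε
      rw [Real.norm_eq_abs, abs_of_nonneg (by positivity), inv_mul_le_iff₀ hε', mul_one]
      exact max_le hε'.le (min_le_left _ _)
    · have := (tendsto_clamp (height R γ y)).const_mul (fderiv ℝ F y v)
      simpa [Set.indicator] using this
  refine le_of_tendsto_of_tendsto hlim.abs (b := nhdsWithin 0 (Set.Ioi 0))
    (g := fun ε : ℝ => (1 + K) * ‖v‖ * ((∫ z, |F (graphMap R γ z)|) + ε * C)) ?_ ?_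
  · have : Continuous fun ε : ℝ => (1 + K) * ‖v‖ * ((∫ z, |F (graphMap R γ z)|) + ε * C) := by
      fun_prop
    simpa using (this.tendsto 0).mono_left nhdsWithin_le_nhds
  · filter_upwards [self_mem_nhdsWithin] with ε hε
    exact hbound ε hε

theorem IsChart.norm_setIntegral_gradient_le (h : IsChart Ω x r R K γ) (hΩ : IsOpen Ω)
    [IsFiniteMeasure (surface Ω)] {F : E d → ℝ} (hF : IsTest (Metric.ball x r) F) :
    ‖∫ y in Ω, gradient F y‖ ≤ (1 + K) * ∫ y, |F y| ∂(surface Ω) := by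
  set I := ∫ y in Ω, gradient F y with hI
  have hi : Integrable (gradient F) (volume.restrict Ω) :=
    ((continuous_gradient hF.contDiff).integrable_of_hasCompactSupport
      (hasCompactSupport_gradient hF.hasCompactSupport)).integrableOn
  have h1 : ‖I‖ ^ 2 = ∫ y in Ω, fderiv ℝ F y I := by
    rw [← real_inner_self_eq_norm_sq]
    nth_rw 2 [hI]
    rw [← integral_inner hi]
    congr 1
    ext y
    rw [real_inner_comm, inner_gradient]
  -- The scalar estimate is used in the direction of the integral `I` itself; one factor `‖I‖` is
  -- then cancelled.
  have h2 := (le_abs_self _).trans (h.abs_setIntegral_fderiv_le hΩ hF I)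
  rw [← h1] at h2
  have h3 := h.integral_comp_graphMap_le hΩ hF.contDiff.continuous hF.hasCompactSupport
    hF.tsupport_subset
  by_cases h0 : ‖I‖ = 0
  · rw [h0]
    exact mul_nonneg (by positivity) (integral_nonneg fun y => abs_nonneg _)
  · have h4 : 0 < ‖I‖ := lt_of_le_of_ne (norm_nonneg _) (Ne.symm h0)
    refine le_of_mul_le_mul_left ?_ h4
    calc ‖I‖ * ‖I‖ ≤ (1 + K) * ‖I‖ * ∫ z, |F (graphMap R γ z)| := by rw [← sq]; exact h2
      _ ≤ (1 + K) * ‖I‖ * ∫ y, |F y| ∂(surface Ω) :=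
        mul_le_mul_of_nonneg_left h3 (by positivity)
      _ = _ := by ring

/-- This is the local trace inequality: the vertical derivative identity is applied to `η φ²`, and
`2 |φ| |∇φ| ≤ φ² + |∇φ|²` absorbs the mixed term. The bounds `M` and `M'` are those of `η` and its
gradient. -/
theorem IsChart.exists_integral_mul_sq_le (h : IsChart Ω x r R K γ) (hΩ : IsOpen Ω)
    (hΩb : Bornology.IsBounded Ω) {η : E d → ℝ} (hη : IsTest (Metric.ball x r) η)
    (hη0 : ∀ y, 0 ≤ η y) :
    ∃ C : ℝ, ∀ φ : E d → ℝ, ContDiff ℝ ∞ φ → ∫ y, η y * (φ y) ^ 2 ∂(surface Ω) ≤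
      C * ∫ y in Ω, ((φ y) ^ 2 + ‖gradient φ y‖ ^ 2) := by
  obtain ⟨M, hM⟩ := hη.contDiff.continuous.bounded_above_of_compact_support hη.hasCompactSupport
  obtain ⟨M', hM'⟩ := (continuous_gradient hη.contDiff).bounded_above_of_compact_support
    (hasCompactSupport_gradient hη.hasCompactSupport)
  refine ⟨(1 + K) ^ (d - 1) * (M + M'), fun φ hφ => ?_⟩
  have hF : IsTest (Metric.ball x r) fun y => η y * (φ y) ^ 2 := hη.mul_left (hφ.pow 2)
  have h1 := h.integral_surface_le hΩ hF.contDiff.continuous hF.hasCompactSupport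
    hF.tsupport_subset (fun y => mul_nonneg (hη0 y) (sq_nonneg _))
  rw [← h.setIntegral_fderiv_up hΩ hF] at h1
  refine h1.trans ?_
  rw [mul_assoc]
  refine mul_le_mul_of_nonneg_left ?_ (by positivity)
  rw [← integral_const_mul]
  have hcont : Continuous fun y => (φ y) ^ 2 + ‖gradient φ y‖ ^ 2 := by
    have := continuous_gradient hφ
    have := hφ.continuous
    fun_prop
  refine integral_mono (hF.integrable_fderiv _).integrableOn
    (((hcont.continuousOn.integrableOn_compact hΩb.isCompact_closure).mono_set
      subset_closure).const_mul _) fun y => ?_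
  have hd := hφ.differentiableAt_infty y
  have hg : gradient (fun y => η y * (φ y) ^ 2) y =
      η y • (φ y • gradient φ y + φ y • gradient φ y) + (φ y) ^ 2 • gradient η y := by
    simp_rw [sq]
    rw [gradient_mul (hη.contDiff.differentiableAt_infty y) (hd.fun_mul hd), gradient_mul hd hd]
  have h2 : fderiv ℝ (fun y => η y * (φ y) ^ 2) y (up R) ≤
      ‖gradient (fun y => η y * (φ y) ^ 2) y‖ := by
    rw [← inner_gradient]
    simpa [norm_up] using real_inner_le_norm (gradient (fun y => η y * (φ y) ^ 2) y) (up R)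
  have h3 : ‖gradient (fun y => η y * (φ y) ^ 2) y‖ ≤
      M * (|φ y| * ‖gradient φ y‖ + |φ y| * ‖gradient φ y‖) + (φ y) ^ 2 * M' := by
    rw [hg]
    refine (norm_add_le _ _).trans (add_le_add ?_ ?_)
    · rw [norm_smul]
      refine mul_le_mul (hM y) ((norm_add_le _ _).trans_eq ?_) (norm_nonneg _)
        ((norm_nonneg _).trans (hM y))
      rw [norm_smul, Real.norm_eq_abs]
    · rw [norm_smul, Real.norm_eq_abs, abs_of_nonneg (sq_nonneg _)]
      exact mul_le_mul_of_nonneg_left (hM' y) (sq_nonneg _)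
  have hM0 : 0 ≤ M := (norm_nonneg _).trans (hM y)
  have hM0' : 0 ≤ M' := (norm_nonneg _).trans (hM' y)
  have h4 := mul_nonneg hM0 (sq_nonneg (|φ y| - ‖gradient φ y‖))
  have h5 := mul_nonneg hM0' (sq_nonneg ‖gradient φ y‖)
  have h6 : |φ y| ^ 2 = φ y ^ 2 := sq_abs _
  have h7 : M * (|φ y| * ‖gradient φ y‖ + |φ y| * ‖gradient φ y‖) + (φ y) ^ 2 * M' ≤
      (M + M') * (φ y ^ 2 + ‖gradient φ y‖ ^ 2) := by
    rw [← h6]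
    linarith
  exact h2.trans (h3.trans h7)

end Chart

end BoundaryEstimates

/-! ### The trace operator, zero traces and the normal trace -/

section Traces

variable {d : ℕ} {Ω : Set (E d)}

theorem norm_sq_Lp_eq_integral {V : Type*} [NormedAddCommGroup V] [InnerProductSpace ℝ V]
    {μ : Measure (E d)} (f : Lp V 2 μ) {g : E d → V} (h : f =ᵐ[μ] g) :
    ‖f‖ ^ 2 = ∫ y, ‖g y‖ ^ 2 ∂μ := by
  rw [← real_inner_self_eq_norm_sq, L2.inner_def]
  refine integral_congr_ae ?_
  filter_upwards [h] with y hy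
  rw [real_inner_self_eq_norm_sq, hy]

theorem exists_norm_le_of_smoothTraceGraph (hΩ : IsBoundedLipschitzDomain Ω) :
    ∃ C : ℝ, ∀ p ∈ smoothTraceGraph Ω, ‖p.2‖ ≤ C * ‖p.1‖ := by
  have := isFiniteMeasure_surface hΩ
  have hK : IsCompact (frontier Ω) :=
    hΩ.isBounded.isCompact_closure.of_isClosed_subset isClosed_frontier frontier_subset_closure
  choose! r R K γ hch using fun x (hx : x ∈ frontier Ω) => hΩ.exists_isChart hx
  obtain ⟨ι, _, c, η, hc, hη, hη0, hsum⟩ := exists_smooth_partition hK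
    (fun x => Metric.ball x (r x)) (fun x hx => Metric.ball_mem_nhds x (hch x hx).pos)
  choose C hC using fun i =>
    (hch (c i) (hc i)).exists_integral_mul_sq_le hΩ.isOpen hΩ.isBounded (hη i) (hη0 i)
  -- The signs of the `C i` are not known, hence the absolute value under the root.
  refine ⟨Real.sqrt |∑ i, C i|, ?_⟩
  rintro ⟨w, f⟩ ⟨φ, hφ, h1, h2⟩
  have hgr := grad_ae_eq_gradient hΩ.isOpen hφ h1
  have hi : ∀ g : E d → ℝ, Continuous g → IntegrableOn g Ω := fun g hg =>
    (hg.continuousOn.integrableOn_compact hΩ.isBounded.isCompact_closure).mono_set subset_closure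
  have hw : ‖w‖ ^ 2 = ∫ y in Ω, ((φ y) ^ 2 + ‖gradient φ y‖ ^ 2) := by
    rw [norm_sq_H1, norm_sq_Lp_eq_integral _ h1, norm_sq_Lp_eq_integral _ hgr, ← integral_add
      (hi _ (by have := hφ.continuous; fun_prop))
      (hi _ (by have := continuous_gradient hφ; fun_prop))]
    simp
  have hf : ‖f‖ ^ 2 = ∑ i, ∫ y, η i y * (φ y) ^ 2 ∂(surface Ω) := by
    rw [norm_sq_Lp_eq_integral _ h2, ← integral_finsetSum]
    · refine integral_congr_ae ?_
      filter_upwards [ae_restrict_mem isClosed_frontier.measurableSet] with y hy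
      rw [← Finset.sum_mul, hsum y hy, one_mul, Real.norm_eq_abs, sq_abs]
    · intro i _
      exact ((hη i).contDiff.continuous.mul (hφ.continuous.pow 2)).integrable_of_hasCompactSupport
        (hη i).hasCompactSupport.mul_right
  have hle : ‖f‖ ^ 2 ≤ |∑ i, C i| * ‖w‖ ^ 2 := by
    rw [hf]
    refine (Finset.sum_le_sum fun i _ => hC i φ hφ).trans ?_
    rw [← Finset.sum_mul, ← hw]
    exact mul_le_mul_of_nonneg_right (le_abs_self _) (sq_nonneg _)
  refine abs_le_of_sq_le_sq' ?_ (by positivity) |>.2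
  rwa [mul_pow, Real.sq_sqrt (abs_nonneg _)]

theorem exists_norm_le_of_traceGraph (hΩ : IsBoundedLipschitzDomain Ω) :
    ∃ C : ℝ, ∀ p ∈ traceGraph Ω, ‖p.2‖ ≤ C * ‖p.1‖ := by
  obtain ⟨C, hC⟩ := exists_norm_le_of_smoothTraceGraph hΩ
  refine ⟨C, fun p hp => ?_⟩
  have hcl : IsClosed {p : H1 Ω × L2Γ Ω | ‖p.2‖ ≤ C * ‖p.1‖} :=
    isClosed_le (by fun_prop) (by fun_prop)
  exact closure_minimal (fun q hq => hC q hq) hcl hp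

/-- The trace inequality makes the projection of the closed graph onto `H1 Ω` bounded below, so its
range is closed. The range contains the restrictions of smooth functions, whose span is dense, hence
it is everything. -/
theorem exists_isTrace (hΩ : IsBoundedLipschitzDomain Ω) (w : H1 Ω) : ∃ f, IsTrace w f := by
  have := isFiniteMeasure_surface hΩ
  obtain ⟨C, hC⟩ := exists_norm_le_of_traceGraph hΩ
  have : CompleteSpace (traceGraph Ω) :=
    (Submodule.isClosed_topologicalClosure _).completeSpace_coe
  let P : traceGraph Ω →ₗ[ℝ] H1 Ω := (LinearMap.fst ℝ (H1 Ω) (L2Γ Ω)).comp (traceGraph Ω).subtype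
  have hP : Continuous P := continuous_fst.comp continuous_subtype_val
  have hanti : AntilipschitzWith (Real.toNNReal (1 + |C|)) P := by
    refine AddMonoidHomClass.antilipschitz_of_bound P fun p => ?_
    rw [Real.coe_toNNReal _ (by positivity)]
    change ‖(p : H1 Ω × L2Γ Ω)‖ ≤ (1 + |C|) * ‖(p : H1 Ω × L2Γ Ω).1‖
    rw [Prod.norm_def]
    have h0 := norm_nonneg (p : H1 Ω × L2Γ Ω).1
    refine max_le ?_ ?_
    · nlinarith [abs_nonneg C]
    · nlinarith [hC p p.2, le_abs_self C]
  have hclosed : IsClosed (LinearMap.range P : Set (H1 Ω)) := by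
    rw [LinearMap.coe_range]
    exact hanti.isClosed_range (⟨P, hP⟩ : traceGraph Ω →L[ℝ] H1 Ω).uniformContinuous
  have hle : Submodule.span ℝ {w : H1 Ω | ∃ (φ : E d → ℝ) (hφ : IsTest Set.univ φ),
      w = ofTest Ω hφ} ≤ LinearMap.range P := by
    rw [Submodule.span_le]
    rintro _ ⟨φ, hφ, rfl⟩
    refine ⟨⟨(ofTest Ω hφ, (hφ.memLp_of_univ (surface Ω)).toLp φ),
      Submodule.le_topologicalClosure _ ⟨φ, hφ.contDiff, fn_ofTest hφ,
        (hφ.memLp_of_univ (surface Ω)).coeFn_toLp⟩⟩, rfl⟩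
  have htop := Submodule.topologicalClosure_minimal _ hle hclosed
  rw [dense_span_ofTest hΩ] at htop
  obtain ⟨p, hp⟩ := htop (Submodule.mem_top (x := w))
  refine ⟨(p : H1 Ω × L2Γ Ω).2, ?_⟩
  rw [IsTrace, ← hp]
  exact p.2

theorem IsTrace.unique (hΩ : IsBoundedLipschitzDomain Ω) {w : H1 Ω} {f g : L2Γ Ω}
    (hf : IsTrace w f) (hg : IsTrace w g) : f = g := by
  obtain ⟨C, hC⟩ := exists_norm_le_of_traceGraph hΩ
  have := hC _ ((traceGraph Ω).sub_mem hf hg)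
  simp only [Prod.mk_sub_mk, sub_self, norm_zero, mul_zero] at this
  exact sub_eq_zero.1 (norm_le_zero_iff.1 this)

theorem integral_abs_mul_le {μ : Measure (E d)} {g φ : E d → ℝ} (hg : MemLp g 2 μ) (f : Lp ℝ 2 μ)
    (h : f =ᵐ[μ] φ) : ∫ y, |g y * φ y| ∂μ ≤ ‖hg.toLp g‖ * ‖f‖ := by
  have h1 : ∫ y, |g y * φ y| ∂μ = inner ℝ |hg.toLp g| |f| := by
    rw [L2.inner_def]
    refine integral_congr_ae ?_
    filter_upwards [h, hg.coeFn_toLp, Lp.coeFn_abs (hg.toLp g), Lp.coeFn_abs f] with y h1 h2 h3 h4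
    rw [h3, h4, h2, h1, abs_mul]
    simp [mul_comm]
  rw [h1]
  refine (real_inner_le_norm _ _).trans_eq ?_
  rw [norm_abs_eq_norm, norm_abs_eq_norm]

/-- Away from the boundary the integral vanishes; at the boundary the chart estimate applies. -/
theorem exists_local_gradient_bound (hΩ : IsBoundedLipschitzDomain Ω) {x : E d}
    (hx : x ∈ closure Ω) : ∃ N ∈ nhds x, ∃ C : ℝ, 0 ≤ C ∧ ∀ F, IsTest N F →
      ‖∫ y in Ω, gradient F y‖ ≤ C * ∫ y, |F y| ∂(surface Ω) := by
  have := isFiniteMeasure_surface hΩ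
  by_cases hxΩ : x ∈ Ω
  · refine ⟨Ω, hΩ.isOpen.mem_nhds hxΩ, 0, le_rfl, fun F hF => ?_⟩
    rw [setIntegral_gradient_eq hF.tsupport_subset,
      integral_gradient_eq_zero ⟨hF.contDiff, hF.hasCompactSupport, Set.subset_univ _⟩]
    simp
  · obtain ⟨r, R, K, γ, hch⟩ := hΩ.exists_isChart (x := x)
      (by rw [hΩ.isOpen.frontier_eq]; exact ⟨hx, hxΩ⟩)
    exact ⟨Metric.ball x r, Metric.ball_mem_nhds x hch.pos, 1 + K, by positivity,
      fun F hF => hch.norm_setIntegral_gradient_le hΩ.isOpen hF⟩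

/-- For fixed `ψ`, the total gradient integral is controlled by the boundary values of `φ` alone.
This form survives passage to the closure of the smooth trace graph. -/
theorem exists_norm_setIntegral_gradient_mul_le (hΩ : IsBoundedLipschitzDomain Ω) {ψ : E d → ℝ}
    (hψ : IsTest Set.univ ψ) : ∃ C : ℝ, ∀ (φ : E d → ℝ) (f : L2Γ Ω), ContDiff ℝ ∞ φ →
      f =ᵐ[surface Ω] φ → ‖∫ y in Ω, gradient (fun y => φ y * ψ y) y‖ ≤ C * ‖f‖ := by
  have := isFiniteMeasure_surface hΩ
  choose! N hN C hC0 hC using fun x (hx : x ∈ closure Ω) => exists_local_gradient_bound hΩ hx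
  obtain ⟨ι, _, c, η, hc, hη, -, hsum⟩ :=
    exists_smooth_partition hΩ.isBounded.isCompact_closure N hN
  have hg : ∀ i, MemLp (fun y => η i y * ψ y) 2 (surface Ω) := fun i =>
    ((hη i).contDiff.continuous.mul hψ.contDiff.continuous).memLp_of_hasCompactSupport
      (hη i).hasCompactSupport.mul_right
  refine ⟨∑ i, C (c i) * ‖(hg i).toLp _‖, fun φ f hφ hf => ?_⟩
  have hF : ∀ i, IsTest (N (c i)) (fun y => (η i y * ψ y) * φ y) := fun i =>
    ((hη i).mul_left hψ.contDiff).mul_left hφ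
  have h1 : ∫ y in Ω, gradient (fun y => φ y * ψ y) y =
      ∑ i, ∫ y in Ω, gradient (fun y => (η i y * ψ y) * φ y) y := by
    rw [← integral_finsetSum]
    · refine setIntegral_congr_fun hΩ.isOpen.measurableSet fun y hy => ?_
      have he : (fun y => φ y * ψ y) =ᶠ[nhds y] fun y => ∑ i, (η i y * ψ y) * φ y := by
        filter_upwards [hΩ.isOpen.mem_nhds hy] with z hz
        rw [← Finset.sum_mul, ← Finset.sum_mul, hsum z (subset_closure hz), one_mul, mul_comm]
      simp only [gradient]
      rw [he.fderiv_eq, fderiv_fun_sum fun i _ => (hF i).contDiff.differentiableAt_infty y, map_sum]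
    · intro i _
      exact ((continuous_gradient (hF i).contDiff).integrable_of_hasCompactSupport
        (hasCompactSupport_gradient (hF i).hasCompactSupport)).integrableOn
  rw [h1, Finset.sum_mul]
  refine (norm_sum_le _ _).trans (Finset.sum_le_sum fun i _ => ?_)
  refine (hC (c i) (hc i) _ (hF i)).trans ?_
  rw [mul_assoc]
  exact mul_le_mul_of_nonneg_left (integral_abs_mul_le (hg i) f hf) (hC0 _ (hc i))

/-- The defect in the weak gradient identity of the extension by zero is at most `C` times the norm
of the trace. This closed condition holds for smooth pairs, hence on the whole trace graph. -/
theorem IsTrace.weakDeriv_univ (hΩ : IsBoundedLipschitzDomain Ω) {w : H1 Ω} (hw : IsTrace w 0) :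
    WeakDeriv (ContinuousLinearMap.lsmul ℝ ℝ) Set.univ (Ω.indicator (fn w))
      (Ω.indicator (grad w)) := by
  intro ψ hψ
  rw [← setIntegral_bilin_indicator hΩ.isOpen, ← setIntegral_smul_indicator hΩ.isOpen]
  obtain ⟨C, hC⟩ := exists_norm_setIntegral_gradient_mul_le hΩ hψ
  have hψ2 := hψ.memLp_of_univ (volume.restrict Ω)
  have hgψ2 := hψ.memLp_gradient_of_univ (volume.restrict Ω)
  have hcl : IsClosed {p : H1 Ω × L2Γ Ω | ‖(∫ x in Ω, (fn p.1) x • gradient ψ x) +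
      ∫ x in Ω, ψ x • (grad p.1) x‖ ≤ C * ‖p.2‖} := by
    refine isClosed_le (Continuous.norm (Continuous.add ?_ ?_)) (by fun_prop)
    · exact (continuous_integral_bilin (ContinuousLinearMap.lsmul ℝ ℝ) hgψ2).comp
        ((WithLp.continuous_fst 2 _ _).comp (continuous_subtype_val.comp continuous_fst))
    · exact (continuous_integral_bilin (ContinuousLinearMap.lsmul ℝ ℝ).flip hψ2).comp
        ((WithLp.continuous_snd 2 _ _).comp (continuous_subtype_val.comp continuous_fst))
  have hmem := closure_minimal (s := (smoothTraceGraph Ω : Set (H1 Ω × L2Γ Ω))) ?_ hcl hw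
  · have h0 : ‖(∫ x in Ω, (fn w) x • gradient ψ x) + ∫ x in Ω, ψ x • (grad w) x‖ ≤
        C * ‖(0 : L2Γ Ω)‖ := hmem
    rw [norm_zero, mul_zero, norm_le_zero_iff] at h0
    exact eq_neg_of_add_eq_zero_left h0
  · rintro ⟨z, f⟩ ⟨φ, hφ, h1, h2⟩
    have hgr := grad_ae_eq_gradient hΩ.isOpen hφ h1
    refine le_trans (le_of_eq ?_) (hC φ f hφ h2)
    congr 1
    rw [← integral_add (integrable_smul_of_memLp (Lp.memLp _) hgψ2)
      (integrable_smul_of_memLp hψ2 (Lp.memLp _))]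
    refine integral_congr_ae ?_
    filter_upwards [h1, hgr] with y h1 h2
    rw [gradient_mul (hφ.differentiableAt_infty y) (hψ.contDiff.differentiableAt_infty y), ← h1,
      ← h2]

theorem IsTrace.inner_grad_add_inner_eq_zero (hΩ : IsBoundedLipschitzDomain Ω) {w : H1 Ω}
    (hw : IsTrace w 0) {σ : L2v Ω} {f : L2 Ω} (hσ : HasWeakDiv Ω σ f) :
    inner ℝ (grad w) σ + inner ℝ (fn w) f = 0 :=
  inner_grad_add_inner_eq_zero_of_grad hΩ w hσ (hw.weakDeriv_univ hΩ)

/-- A function whose gradient vanishes is the divergence of a square integrable field. -/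
theorem exists_hasWeakDiv_fn (hd : 0 < d) (hΩ : IsBoundedLipschitzDomain Ω) {w : H1 Ω}
    (hw : grad w = 0) : ∃ σ : L2v Ω, HasWeakDiv Ω σ (fn w) := by
  obtain ⟨η, hη, hη1⟩ := exists_test_eq_one hΩ.isBounded.isCompact_closure isOpen_univ
    (Set.subset_univ _)
  -- The field is `x₀ w e`, with `e` the first unit vector and the coordinate `x₀` cut off outside
  -- the closure of `Ω`. Its divergence is `w` because the gradient of `w` vanishes. `Ω` may be
  -- disconnected, and this avoids treating `w` as constant.
  set e : E d := EuclideanSpace.single ⟨0, hd⟩ 1 with he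
  have hee : inner ℝ e e = 1 := by
    rw [real_inner_self_eq_norm_sq, he]
    simp
  have hlin : ContDiff ℝ ∞ fun x : E d => inner ℝ e x := contDiff_const.inner ℝ contDiff_id
  have hk : IsTest Set.univ fun x => η x * inner ℝ e x := hη.mul_left hlin
  set k : E d → ℝ := fun x => η x * inner ℝ e x with hkdef
  have hgk : ∀ x ∈ Ω, inner ℝ (gradient k x) e = 1 := by
    intro x hx
    have h1 := hη1 x (subset_closure hx)
    rw [hkdef, gradient_mul (hη.contDiff.differentiableAt_infty x)
      (hlin.differentiableAt_infty x), h1.1, h1.2, smul_zero, add_zero, one_smul, inner_gradient]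
    have : HasFDerivAt (fun x : E d => inner ℝ e x) (innerSL ℝ e) x := (innerSL ℝ e).hasFDerivAt
    rw [this.fderiv]
    exact hee
  have hm : MemLp (fun x => k x • ((fn w) x • e)) 2 (volume.restrict Ω) := by
    refine memLp_smul ?_ hk.contDiff.continuous hk.hasCompactSupport
    exact (ContinuousLinearMap.toSpanSingleton ℝ e).comp_memLp' (Lp.memLp (fn w))
  refine ⟨hm.toLp _, fun φ hφ => ?_⟩
  have hT : IsTest Ω fun x => k x * φ x := hφ.mul hk.contDiff
  have h1 := w.2 _ hT
  -- Testing the vanishing gradient with `k φ` and taking the component along `e` gives the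
  -- divergence identity, as the derivative of `k` along `e` is `1` on `Ω`.
  have h2 : ∫ x in Ω, (k x * φ x) • (grad w) x = 0 := by
    rw [hw]
    refine integral_eq_zero_of_ae ?_
    filter_upwards [Lp.coeFn_zero (E d) 2 (volume.restrict Ω)] with x hx
    rw [hx]
    simp
  have h3 : ∫ x in Ω, (fn w) x • gradient (fun x => k x * φ x) x = 0 := by
    refine h1.trans ?_
    rw [neg_eq_zero]
    exact h2
  have i1 : Integrable (fun x => (fn w) x • gradient (fun x => k x * φ x) x) (volume.restrict Ω) :=
    integrable_smul_of_memLp (Lp.memLp _) hT.memLp_gradient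
  have h4 : ∫ x in Ω, inner ℝ e ((fn w) x • gradient (fun x => k x * φ x) x) = 0 := by
    rw [integral_inner i1, h3, inner_zero_right]
  have i2 : Integrable (fun x => (fn w) x * φ x) (volume.restrict Ω) :=
    integrable_smul_of_memLp (Lp.memLp _) hφ.memLp
  rw [eq_neg_iff_add_eq_zero, ← integral_add _ i2, ← h4]
  · refine integral_congr_ae ?_
    filter_upwards [hm.coeFn_toLp, ae_restrict_mem hΩ.isOpen.measurableSet] with x hx hxΩ
    have hgk' : inner ℝ e (gradient k x) = 1 := by rw [real_inner_comm, hgk x hxΩ]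
    rw [hx, gradient_mul (hk.contDiff.differentiableAt_infty x)
      (hφ.contDiff.differentiableAt_infty x), real_inner_smul_left, real_inner_smul_left,
      real_inner_smul_right, inner_add_right, real_inner_smul_right, real_inner_smul_right, hgk']
    ring
  · exact integrable_inner (Lp.memLp _) hφ.memLp_gradient

/-- With `w = div σ`, Green's formula for zero trace reads `‖w‖² = -(∇w, σ) = 0`. This replaces a
Poincaré inequality. -/
theorem eq_zero_of_isTrace_zero (hd : 0 < d) (hΩ : IsBoundedLipschitzDomain Ω) {w : H1 Ω}
    (ht : IsTrace w 0) (hw : grad w = 0) : w = 0 := by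
  obtain ⟨σ, hσ⟩ := exists_hasWeakDiv_fn hd hΩ hw
  have h := ht.inner_grad_add_inner_eq_zero hΩ hσ
  rw [hw, inner_zero_left, zero_add] at h
  rw [← norm_eq_zero, ← sq_eq_zero_iff, norm_sq_H1, hw, ← real_inner_self_eq_norm_sq, h]
  simp

theorem isTrace_trace (hΩ : IsBoundedLipschitzDomain Ω) (w : H1 Ω) :
    IsTrace w (trace w : L2Γ Ω) := by
  obtain ⟨f, hf⟩ := exists_isTrace hΩ w
  exact Classical.epsilon_spec (p := fun f : Hhalf Ω => IsTrace w (f : L2Γ Ω))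
    ⟨⟨f, ⟨(w, f), hf, rfl⟩⟩, hf⟩

theorem IsTrace.trace_eq (hΩ : IsBoundedLipschitzDomain Ω) {w : H1 Ω} {f : Hhalf Ω}
    (h : IsTrace w (f : L2Γ Ω)) : trace w = f :=
  Subtype.ext ((isTrace_trace hΩ w).unique hΩ h)

theorem IsTrace.sub {w z : H1 Ω} {f g : L2Γ Ω} (hw : IsTrace w f) (hz : IsTrace z g) :
    IsTrace (w - z) (f - g) := (traceGraph Ω).sub_mem hw hz

theorem IsTrace.add {w z : H1 Ω} {f g : L2Γ Ω} (hw : IsTrace w f) (hz : IsTrace z g) :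
    IsTrace (w + z) (f + g) := (traceGraph Ω).add_mem hw hz

theorem IsTrace.smul {w : H1 Ω} {f : L2Γ Ω} (c : ℝ) (hw : IsTrace w f) :
    IsTrace (c • w) (c • f) := (traceGraph Ω).smul_mem c hw

theorem trace_sub (hΩ : IsBoundedLipschitzDomain Ω) (w z : H1 Ω) :
    trace (w - z) = trace w - trace z :=
  IsTrace.trace_eq hΩ ((isTrace_trace hΩ w).sub (isTrace_trace hΩ z))

theorem grad_sub (w z : H1 Ω) : grad (w - z) = grad w - grad z := rfl

theorem norm_grad_le (w : H1 Ω) : ‖grad w‖ ≤ ‖w‖ :=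
  abs_le_of_sq_le_sq' (by rw [norm_sq_H1]; nlinarith [sq_nonneg ‖fn w‖]) (norm_nonneg _) |>.2

theorem norm_fn_le (w : H1 Ω) : ‖fn w‖ ≤ ‖w‖ :=
  abs_le_of_sq_le_sq' (by rw [norm_sq_H1]; nlinarith [sq_nonneg ‖grad w‖]) (norm_nonneg _) |>.2

/-- The choice in `normalTrace` is meaningful once some functional satisfies Green's formula. It is
built from an arbitrary lift of each boundary function; two lifts differ by a function of zero
trace, on which the right side vanishes. -/
theorem dualPairing_normalTrace (hΩ : IsBoundedLipschitzDomain Ω) (σ : Hdiv Ω) (φ : H1 Ω)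
    (f : Hhalf Ω) (h : IsTrace φ (f : L2Γ Ω)) :
    dualPairing f (normalTrace σ) = inner ℝ (grad φ) σ.field + inner ℝ (fn φ) σ.div := by
  suffices hex : ∃ ℓ : HmHalf Ω, ∀ (φ : H1 Ω) (f : Hhalf Ω), IsTrace φ (f : L2Γ Ω) →
      dualPairing f ℓ = inner ℝ (grad φ) σ.field + inner ℝ (fn φ) σ.div from
    Classical.epsilon_spec hex φ f h
  let Λ : H1 Ω → ℝ := fun φ => inner ℝ (grad φ) σ.field + inner ℝ (fn φ) σ.div
  have hΛ : ∀ φ ψ : H1 Ω, ∀ f : L2Γ Ω, IsTrace φ f → IsTrace ψ f → Λ φ = Λ ψ := by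
    intro φ ψ f hφ hψ
    have h1 := hφ.sub hψ
    rw [sub_self] at h1
    have h2 := h1.inner_grad_add_inner_eq_zero hΩ σ.hasWeakDiv
    have h3 : grad (φ - ψ) = grad φ - grad ψ := rfl
    have h4 : fn (φ - ψ) = fn φ - fn ψ := rfl
    rw [h3, h4, inner_sub_left, inner_sub_left] at h2
    simp only [Λ]
    linarith
  have hlift : ∀ f : Hhalf Ω, ∃ w : H1 Ω, IsTrace w (f : L2Γ Ω) := by
    rintro ⟨f, ⟨w, g⟩, hp, rfl⟩
    exact ⟨w, hp⟩
  choose s hs using hlift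
  let ℓ : Module.Dual ℝ (Hhalf Ω) :=
    { toFun := fun f => Λ (s f)
      map_add' := fun f g => by
        rw [hΛ _ _ _ (hs (f + g)) ((hs f).add (hs g))]
        have h3 : grad (s f + s g) = grad (s f) + grad (s g) := rfl
        have h4 : fn (s f + s g) = fn (s f) + fn (s g) := rfl
        simp only [Λ]
        rw [h3, h4, inner_add_left, inner_add_left]
        ring
      map_smul' := fun c f => by
        rw [hΛ _ _ _ (hs (c • f)) ((hs f).smul c)]
        have h3 : grad (c • s f) = c • grad (s f) := rfl
        have h4 : fn (c • s f) = c • fn (s f) := rfl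
        simp only [Λ]
        rw [h3, h4, real_inner_smul_left, real_inner_smul_left, RingHom.id_apply, smul_eq_mul]
        ring }
  have hℓ : ∀ (φ : H1 Ω) (f : Hhalf Ω), IsTrace φ (f : L2Γ Ω) → ℓ f = Λ φ :=
    fun φ f hφ => hΛ _ _ _ (hs f) hφ
  refine ⟨⟨ℓ, ‖σ.field‖ + ‖σ.div‖, fun φ f hφ => ?_⟩, hℓ⟩
  rw [hℓ φ f hφ]
  calc |Λ φ| ≤ |inner ℝ (grad φ) σ.field| + |inner ℝ (fn φ) σ.div| := abs_add_le _ _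
    _ ≤ ‖grad φ‖ * ‖σ.field‖ + ‖fn φ‖ * ‖σ.div‖ :=
      add_le_add (abs_real_inner_le_norm _ _) (abs_real_inner_le_norm _ _)
    _ ≤ ‖φ‖ * ‖σ.field‖ + ‖φ‖ * ‖σ.div‖ :=
      add_le_add (mul_le_mul_of_nonneg_right (norm_grad_le φ) (norm_nonneg _))
        (mul_le_mul_of_nonneg_right (norm_fn_le φ) (norm_nonneg _))
    _ = _ := by ring

theorem IsHarmonic.sub {u v : H1 Ω} (hu : IsHarmonic u) (hv : IsHarmonic v) :
    IsHarmonic (u - v) := by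
  intro φ hφ
  have h0 : ∫ x in Ω, (0 : L2 Ω) x * φ x = 0 := by
    refine integral_eq_zero_of_ae ?_
    filter_upwards [Lp.coeFn_zero ℝ 2 (volume.restrict Ω)] with x hx
    rw [hx]
    simp
  have h1 := hu φ hφ
  have h2 := hv φ hφ
  rw [h0, neg_zero] at h1 h2 ⊢
  have h3 : ∫ x in Ω, inner ℝ (grad (u - v) x) (gradient φ x) =
      (∫ x in Ω, inner ℝ (grad u x) (gradient φ x)) -
        ∫ x in Ω, inner ℝ (grad v x) (gradient φ x) := by
    rw [← integral_sub (integrable_inner (Lp.memLp _) hφ.memLp_gradient)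
      (integrable_inner (Lp.memLp _) hφ.memLp_gradient)]
    refine integral_congr_ae ?_
    filter_upwards [Lp.coeFn_sub (grad u) (grad v)] with x hx
    rw [grad_sub, hx, Pi.sub_apply, inner_sub_left]
  rw [h3, h1, h2, sub_zero]

end Traces

end FunctionalError

end

/-! ### The maximum and minimum principles -/

open FunctionalError in
theorem theorem3p1 {d : ℕ} (hd : 2 ≤ d) (Ω : Set (E d)) (hΩ : IsBoundedLipschitzDomain Ω)
    (g : Hhalf Ω) (u : H1 Ω) (hu : IsHarmonic u) (hug : trace u = g)
    (v : H1 Ω) (hv : IsHarmonic v) :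
    -- maximum over solenoidal fields, with unique maximiser
    IsGreatest {m : ℝ | ∃ τ : Hdiv Ω, τ.div = 0 ∧ minorant τ (trace v) g = m}
      (‖grad (u - v)‖ ^ 2) ∧
    (∀ τ : Hdiv Ω, τ.div = 0 →
      (minorant τ (trace v) g = ‖grad (u - v)‖ ^ 2 ↔ τ.field = grad (u - v))) ∧
    -- minimum over functions with the prescribed trace, with unique minimiser
    IsLeast {m : ℝ | ∃ w : H1 Ω, trace w = g - trace v ∧ majorant (grad w) = m}
      (‖grad (u - v)‖ ^ 2) ∧
    trace (u - v) = g - trace v ∧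
    (∀ w : H1 Ω, trace w = g - trace v →
      (majorant (grad w) = ‖grad (u - v)‖ ^ 2 ↔ w = u - v)) := by
  have htr : trace (u - v) = g - trace v := by rw [trace_sub hΩ, hug]
  have hharm : IsHarmonic (u - v) := hu.sub hv
  -- Here `u - v` serves as the lift of `g - trace v` in Green's formula, and the square is
  -- completed.
  have hmin : ∀ τ : Hdiv Ω, τ.div = 0 → minorant τ (trace v) g =
      ‖grad (u - v)‖ ^ 2 - ‖τ.field - grad (u - v)‖ ^ 2 := by
    intro τ hτ
    rw [minorant, dualPairing_normalTrace hΩ τ (u - v) (g - trace v)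
      (htr ▸ isTrace_trace hΩ (u - v)), hτ, inner_zero_right, add_zero, norm_sub_sq_real,
      real_inner_comm]
    ring
  have hmaj : ∀ w : H1 Ω, trace w = g - trace v → IsTrace (w - (u - v)) 0 ∧
      majorant (grad w) = ‖grad (u - v)‖ ^ 2 + ‖grad (w - (u - v))‖ ^ 2 := by
    intro w hw
    have h0 : IsTrace (w - (u - v)) 0 := by
      have := (isTrace_trace hΩ w).sub (isTrace_trace hΩ (u - v))
      rwa [hw, htr, sub_self] at this
    refine ⟨h0, ?_⟩
    -- Harmonicity of `u - v` makes its gradient solenoidal, so the cross term in Pythagoras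
    -- vanishes.
    have h1 := h0.inner_grad_add_inner_eq_zero hΩ hharm
    rw [inner_zero_right, add_zero, real_inner_comm] at h1
    have h2 : grad w = grad (u - v) + grad (w - (u - v)) := by
      rw [grad_sub w (u - v), add_sub_cancel]
    rw [majorant, h2, norm_add_sq_real, h1]
    ring
  refine ⟨⟨⟨⟨grad (u - v), 0, hharm⟩, rfl, ?_⟩, ?_⟩, fun τ hτ => ?_,
    ⟨⟨u - v, htr, rfl⟩, ?_⟩, htr, fun w hw => ?_⟩
  · rw [hmin _ rfl]
    simp
  · rintro _ ⟨τ, hτ, rfl⟩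
    rw [hmin τ hτ]
    linarith [sq_nonneg ‖τ.field - grad (u - v)‖]
  · rw [hmin τ hτ, sub_eq_self, sq_eq_zero_iff, norm_eq_zero, sub_eq_zero]
  · rintro _ ⟨w, hw, rfl⟩
    rw [(hmaj w hw).2]
    linarith [sq_nonneg ‖grad (w - (u - v))‖]
  · rw [(hmaj w hw).2, add_eq_left, sq_eq_zero_iff, norm_eq_zero]
    refine ⟨fun h => sub_eq_zero.1 (eq_zero_of_isTrace_zero (by omega) hΩ (hmaj w hw).1 h),
      fun h => ?_⟩
    rw [h, sub_self]
    rfl
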